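/- **Setting.** Let $\mathcal X$ be a set of features, $\mathcal Y=[M]$ a label set, $\mathcal D(\mathcal Y)$ the set of probability vectors on $\mathcal Y$, and $\mathcal F=\{f_1,\dots,f_K\}$ with $f_j:\mathcal X\to\mathcal D(\mathcal Y)$. A privatization scheme $\mathcal R=(\mathcal R_1,\dots,\mathcal R_T)$ gives for each round $t$, feature $x$ and label $y$ a probability law $\mathcal R_t(x,y)$ on $\mathbb R^K$; it is $(\epsilon,\delta)$-locally differentially private if $\mathcal R_t(x,y)(S)\le e^{\epsilon}\mathcal R_t(x,y')(S)+\delta$ for all $t,x,y,y'$ and measurable $S\subseteq\mathbb R^K$. A learner $\Phi=(\Phi_1,\dots,\Phi_T)$ predicts $\hat p_t=\Phi_t(x_1,\dots,x_t,\tilde Y_1,\dots,\tilde Y_{t-1})\in\mathcal D(\mathcal Y)$, measurably in the messages. With true function $f\in\mathcal F$ and features $x^T$, the labels $Y_t\sim f(x_t)$ are independent and $\tilde Y_t\sim\mathcal R_t(x_t,Y_t)$ with independent randomness in each round. The worst-case KL-risk of $(\mathcal R,\Phi)$ is $$\sup_{f\in\mathcal F,\ x^T\in\mathcal X^T}\mathbb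 E\Big[\sum_{t=1}^T \mathsf{KL}(f(x_t),\hat p_t)\Big],\qquad \mathsf{KL}(p,q)=\sum_y p[y]\log\frac{p[y]}{q[y]},$$ and $r^{\mathsf{KL}}_T(\mathcal F)$ is its infimum over all $(\epsilon,\delta)$-locally differentially private $\mathcal R$ and all learners $\Phi$. **Locally privatized weighted majority.** Fix a feature $x$, put $n_y=\lceil M\max_j f_j(x)[y]\rceil$ and $N=\sum_y n_y$, and partition $[N]$ into sets $S_y$ with $|S_y|=n_y$. The random map $h:\mathcal Y\to[N]$ sends $y$ to a uniform element of $S_y$ with probability $1-\frac1T$ and to a uniform element of $[N]$ with probability $\frac1T$ (if $n_y=0$, always to a uniform element of $[N]$). Let $\bar p_j$ be the law of $h(y)$ for $y\sim f_j(x)$. Put $$b=\frac{\big(2\sqrt{2K\ln\frac1\delta}+\sqrt{K\epsilon}\big)\log(KT)}{\epsilon},\qquad c'=b\,(\gamma+\log K+\log T),\qquad c=\frac1{\log(KT)+2c'},\qquad \gamma=\log T.$$ The message for the label $y$ is the vector with coordinates $-c\big(\log\bar p_j[h(y)]+\mathrm{Lap}_j+\log M-c'\big)$, $j\in[K]$,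 where one sample of $h(y)$ is used for all coordinates and the $\mathrm{Lap}_j$ are independent centred Laplace variables with scale $b$. The learner keeps weights $w^1_j=1$, $w_j^{t+1}=w_j^te^{-\eta\tilde Y_{t,j}}$ with $\eta=\sqrt{2\log K/T}$, and, with $\bar p_j$, $S_y$ computed at $x=x_t$, predicts $$\hat p_t[y]=\sum_{y'\in S_y}\sum_{j=1}^K\frac{w^t_j}{\sum_i w^t_i}\,\bar p_j[y'].$$ **Theorem.** There is a universal constant $C>0$ such that for all $\mathcal X$, all $M,K,T\ge1$, all $\epsilon>0$, $0<\delta\le1$, and every class $\mathcal F=\{f_1,\dots,f_K\}$, with $$B=\sqrt{2T\log K}\left(\log(KT)+\frac{\big(\sqrt{K\ln\frac1\delta}+\sqrt{K\epsilon}\big)\log^2(KT)}{\epsilon}\right):$$ 1. there are an $(\epsilon,\delta)$-locally differentially private scheme and a learner whose worst-case KL-risk is at most $C\,B$; in particular $r_T^{\mathsf{KL}}(\mathcal F)\le C\,B$, a bound that does not depend on $M$; 2. if $K\ge2$, the locally privatized weighted majority scheme and learner above have these properties: the scheme is $(\epsilon,\delta)$-locally differentially private and the worst-case KL-risk of the pair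 is at most $C\,B$. -/

import Mathlib

open MeasureTheory
open scoped ENNReal

noncomputable section

namespace PrivateOnline

/-! ### The online estimation game -/

/-- Kullback-Leibler divergence `∑ y, p y * log (p y / q y)` of two probability vectors, with the
conventions `0 * log (0 / q) = 0` and `p * log (p / 0) = ∞` for `p > 0`. -/
def kl {M : ℕ} (p q : Fin M → ℝ) : ℝ≥0∞ :=
  open scoped Classical in
  if ∀ y, q y = 0 → p y = 0 then ENNReal.ofReal (∑ y, p y * Real.log (p y / q y)) else ⊤

/-- A privatization scheme: in round `t`, with feature `x`, the label `y` is replaced by a random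
message in `ℝ^K` with law `R t x y`. Different rounds use independent randomness. -/
abbrev Mechanism (X : Type*) (M K T : ℕ) := Fin T → X → Fin M → Measure (Fin K → ℝ)

/-- A learner: in round `t` it maps the features of the rounds `≤ t` and the messages of the
rounds `< t` to a vector indexed by the labels. -/
abbrev Learner (X : Type*) (M K T : ℕ) :=
  (t : Fin T) → (Set.Iic t → X) → (Set.Iio t → Fin K → ℝ) → Fin M → ℝ

/-- The scheme is `(ε, δ)`-locally differentially private. -/
def IsLDP {X : Type*} {M K T : ℕ} (ε δ : ℝ) (R : Mechanism X M K T) : Prop :=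
  (∀ t x y, IsProbabilityMeasure (R t x y)) ∧
    ∀ t x y y' S, MeasurableSet S →
      R t x y S ≤ ENNReal.ofReal (Real.exp ε) * R t x y' S + ENNReal.ofReal δ

/-- The learner always predicts a probability vector, measurably in the received messages. -/
def IsLearner {X : Type*} {M K T : ℕ} (Φ : Learner X M K T) : Prop :=
  ∀ t x, Measurable (Φ t x) ∧ ∀ z, Φ t x z ∈ stdSimplex ℝ (Fin M)

/-- The law of the message when the label is drawn from `p` and then privatized by `A`. -/
def messageLaw {M K : ℕ} (A : Fin M → Measure (Fin K → ℝ)) (p : Fin M → ℝ) :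
    Measure (Fin K → ℝ) :=
  ∑ y, ENNReal.ofReal (p y) • A y

/-- The expected cumulative KL divergence when the features are `x` and the labels are drawn
independently from `f (x t)`. -/
def expectedKL {X : Type*} {M K T : ℕ} (R : Mechanism X M K T) (Φ : Learner X M K T)
    (f : X → stdSimplex ℝ (Fin M)) (x : Fin T → X) : ℝ≥0∞ :=
  ∫⁻ z : Fin T → Fin K → ℝ,
    ∑ t, kl (f (x t)) (Φ t (fun s => x s) (fun s => z s))
    ∂(Measure.pi fun t => messageLaw (R t (x t)) (f (x t)))

/-- The worst case, over the true hypothesis and the features, of the expected cumulative KL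
divergence. -/
def worstKL {X : Type*} {M K T : ℕ} (F : Fin K → X → stdSimplex ℝ (Fin M))
    (R : Mechanism X M K T) (Φ : Learner X M K T) : ℝ≥0∞ :=
  ⨆ (j : Fin K) (x : Fin T → X), expectedKL R Φ (F j) x

/-- The minimax KL-risk under `(ε, δ)`-local differential privacy. -/
def minimaxKL {X : Type*} {M K : ℕ} (T : ℕ) (ε δ : ℝ) (F : Fin K → X → stdSimplex ℝ (Fin M)) :
    ℝ≥0∞ :=
  ⨅ (R : Mechanism X M K T) (Φ : Learner X M K T) (_ : IsLDP ε δ R) (_ : IsLearner Φ),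
    worstKL F R Φ

/-! ### Clipping of the likelihoods

All definitions of this section concern one feature; `p j` is the distribution of hypothesis `j`
at that feature. -/

/-- The number `⌈M * max_j p_j[y]⌉` of cells that the label `y` is split into. -/
def cellCount {M K : ℕ} (p : Fin K → Fin M → ℝ) (y : Fin M) : ℕ :=
  ⌈(M : ℝ) * ⨆ j, p j y⌉₊

/-- The extended label set, partitioned into the cells `⟨y, _⟩` of the labels `y`. -/
abbrev Cell {M K : ℕ} (p : Fin K → Fin M → ℝ) := Σ y : Fin M, Fin (cellCount p y)

/-- The probability that the clipping function sends the label `y` to the cell `c`: uniform on the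
cells of `y` with probability `1 - 1/T`, and uniform on all cells with probability `1/T`.
A label without cells, which has probability zero under all hypotheses, is always sent to a uniform
cell. -/
def clipProb {M K : ℕ} (T : ℕ) (p : Fin K → Fin M → ℝ) (y : Fin M) (c : Cell p) : ℝ :=
  (1 - 1 / (T : ℝ)) *
      (if cellCount p y = 0 then 1 / (Fintype.card (Cell p) : ℝ)
        else if c.1 = y then 1 / (cellCount p y : ℝ) else 0)
    + 1 / ((T : ℝ) * (Fintype.card (Cell p) : ℝ))

/-- The clipped distribution of hypothesis `j`: the law of the cell when the label is drawn
from `p j`. -/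
def clipped {M K : ℕ} (T : ℕ) (p : Fin K → Fin M → ℝ) (j : Fin K) (c : Cell p) : ℝ :=
  ∑ y, clipProb T p y c * p j y

/-! ### The privatization scheme -/

/-- The centred Laplace distribution with scale `b`. -/
def laplace (b : ℝ) : Measure ℝ :=
  volume.withDensity fun x => ENNReal.ofReal (1 / (2 * b) * Real.exp (-|x| / b))

/-- The scale of the Laplace noise. -/
def noiseScale (K T : ℕ) (ε δ : ℝ) : ℝ :=
  (2 * Real.sqrt (2 * K * Real.log (1 / δ)) + Real.sqrt (K * ε)) * Real.log (K * T) / ε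

/-- The offset `c'(γ)` of the losses. -/
def offset (K T : ℕ) (ε δ γ : ℝ) : ℝ :=
  noiseScale K T ε δ * (γ + Real.log K + Real.log T)

/-- The normalization `c(γ)` of the losses. -/
def normalization (K T : ℕ) (ε δ γ : ℝ) : ℝ :=
  1 / (Real.log (K * T) + 2 * offset K T ε δ γ)

/-- The loss vector belonging to the cell `c` and the noise vector `l`. -/
def lossVector {M K : ℕ} (T : ℕ) (ε δ γ : ℝ) (p : Fin K → Fin M → ℝ) (c : Cell p)
    (l : Fin K → ℝ) : Fin K → ℝ := fun j =>
  -normalization K T ε δ γ *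
    (Real.log (clipped T p j c) + l j + Real.log M - offset K T ε δ γ)

/-- The label is sent to a random cell, and the vector of the clipped log-likelihoods of that cell
under all hypotheses is released after adding independent Laplace noise to its coordinates and an
affine rescaling. -/
def laplaceMechanism {X : Type*} {M K : ℕ} (T : ℕ) (ε δ γ : ℝ)
    (F : Fin K → X → stdSimplex ℝ (Fin M)) : Mechanism X M K T := fun _ x y =>
  ∑ c : Cell (fun j => F j x), ENNReal.ofReal (clipProb T (fun j => F j x) y c) •
    (Measure.pi fun _ : Fin K => laplace (noiseScale K T ε δ)).map
      (lossVector T ε δ γ (fun j => F j x) c)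

/-! ### The weighted majority learner -/

/-- The weight of hypothesis `j` before round `t`: it starts at `1` and is multiplied by
`exp (-η * z s j)` in every round `s < t`, where `z s` is the loss vector of round `s`. -/
def weight {K T : ℕ} (η : ℝ) {t : Fin T} (z : Set.Iio t → Fin K → ℝ) (j : Fin K) : ℝ :=
  ∏ s, Real.exp (-η * z s j)

/-- The normalized weights. -/
def normWeight {K T : ℕ} (η : ℝ) {t : Fin T} (z : Set.Iio t → Fin K → ℝ) (j : Fin K) : ℝ :=
  weight η z j / ∑ i, weight η z i

/-- The weighted majority learner with learning rate `√(2 log K / T)`: it averages the clipped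
distributions at the current feature with the normalized weights, and predicts for each label the
total mass of its cells. -/
def wmaLearner {X : Type*} {M K : ℕ} (T : ℕ) (F : Fin K → X → stdSimplex ℝ (Fin M)) :
    Learner X M K T := fun t x z y =>
  let p : Fin K → Fin M → ℝ := fun j => F j (x ⟨t, Set.self_mem_Iic⟩)
  ∑ i : Fin (cellCount p y),
    ∑ j, normWeight (Real.sqrt (2 * Real.log K / T)) z j * clipped T p j ⟨y, i⟩

/-! ### The rate -/

/-- `√(2T log K) (log (KT) + (√(K ln(1/δ)) + √(Kε)) log²(KT) / ε)`. -/
def rate (K T : ℕ) (ε δ : ℝ) : ℝ :=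
  Real.sqrt (2 * T * Real.log K) *
    (Real.log (K * T) +
      (Real.sqrt (K * Real.log (1 / δ)) + Real.sqrt (K * ε)) * Real.log (K * T) ^ 2 / ε)

end PrivateOnline

end

/-!
The scheme is private because of a sharp form of the composition of Laplace mechanisms. Each
released coordinate is a clipped log-likelihood plus Laplace noise. Clipping bounds the
log-likelihoods, up to the common shift `log M`, within a window whose length is of order
`log (K * T)` (`log_clipped_sub_le`): the cells of a label carry mass at most `1 / M` each, and there
are at most `M * (K + 1)` of them. The privacy loss of one coordinate is then bounded by some `r`, and
its mean is at most `r² / 2`, because the exponential of its negative has mean one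
(`integral_le_of_integral_exp_neg`). Hoeffding's inequality for the sum over the coordinates bounds
the total privacy loss by `ε` outside an event of probability `δ` (`laplace_shift_le`). The random
choice of the cell only mixes such laws (`sum_smul_apply_le`).

For the risk, the learner is an exponential weights forecaster whose losses are the noisy
log-likelihoods. These losses are unbounded, but no good event is needed. The logarithm of the
growth factor of the total weight is bounded by the logarithm of its conditional mean, plus a term of
nonpositive mean, so that only the exponential moments of the losses enter
(`lintegral_sum_cost_le`). The exponential moments factor into the moment generating function of the
Laplace distribution and that of a bounded variable, so that the mixed cumulant equals the mean loss
up to a term of second order in the learning rate (`mul_regret_le`, `cumulant_le`). The noise is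
centred and independent of the past, hence the mean regret in the released losses is the mean
regret in logarithmic loss on the cells. By concavity of the logarithm this dominates the relative
entropy of the clipped distribution with respect to the mixture, which in turn dominates the relative
entropy of the true label distribution with respect to the prediction up to a term of order
`log (K * T) / T` (`kl_mixture_le`). Summing over the rounds gives the rate (`regret_le_rate`).

With a single hypothesis the rate vanishes, and predicting that hypothesis has no risk.
-/

namespace PrivateOnline

section ProductAndPrivacy

open ProbabilityTheory

/-! ### Auxiliary facts on product measures -/

theorem lintegral_pi_prod {ι : Type*} [Fintype ι] {E : ι → Type*} [∀ i, MeasurableSpace (E i)]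
    (μ : ∀ i, Measure (E i)) [∀ i, IsProbabilityMeasure (μ i)] {f : ∀ i, E i → ℝ≥0∞}
    (hf : ∀ i, Measurable (f i)) :
    ∫⁻ x, ∏ i, f i (x i) ∂(Measure.pi μ) = ∏ i, ∫⁻ x, f i x ∂(μ i) := by
  have h := lintegral_prod_eq_prod_lintegral_of_indepFun Finset.univ
    (fun i (x : ∀ i, E i) => f i (x i))
    (iIndepFun_pi (μ := μ) (X := f) fun i => (hf i).aemeasurable)
    fun i => (hf i).comp (measurable_pi_apply i)
  rw [h]
  refine Finset.prod_congr rfl fun i _ => ?_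
  exact (measurePreserving_eval μ i).lintegral_comp (hf i)

theorem pi_withDensity {ι : Type*} [Fintype ι] {E : ι → Type*} [∀ i, MeasurableSpace (E i)]
    (μ : ∀ i, Measure (E i)) [∀ i, IsProbabilityMeasure (μ i)] {f : ∀ i, E i → ℝ≥0∞}
    (hf : ∀ i, Measurable (f i)) [∀ i, SigmaFinite ((μ i).withDensity (f i))] :
    Measure.pi (fun i => (μ i).withDensity (f i)) =
      (Measure.pi μ).withDensity fun x => ∏ i, f i (x i) := by
  refine Measure.pi_eq fun s hs => ?_
  rw [withDensity_apply _ (MeasurableSet.univ_pi hs), ← lintegral_indicator (.univ_pi hs)]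
  have h : (Set.univ.pi s).indicator (fun x : ∀ i, E i => ∏ i, f i (x i)) =
      fun x => ∏ i, (s i).indicator (f i) (x i) := by
    ext x
    by_cases hx : x ∈ Set.univ.pi s
    · rw [Set.indicator_of_mem hx]
      exact Finset.prod_congr rfl fun i _ => (Set.indicator_of_mem (hx i trivial) _).symm
    · rw [Set.indicator_of_notMem hx]
      obtain ⟨i, hi⟩ : ∃ i, x i ∉ s i := by simpa using hx
      exact (Finset.prod_eq_zero (Finset.mem_univ i) (Set.indicator_of_notMem hi _)).symm
  rw [h, lintegral_pi_prod μ fun i => (hf i).indicator (hs i)]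
  refine Finset.prod_congr rfl fun i _ => ?_
  rw [lintegral_indicator (hs i), withDensity_apply _ (hs i)]

/-- A function on a product space has integral at most `B` if all its integrals over one fixed
coordinate are at most `B`. -/
theorem lintegral_pi_le_of_update {ι : Type*} [Fintype ι] [DecidableEq ι] {E : ι → Type*}
    [∀ i, MeasurableSpace (E i)] (μ : ∀ i, Measure (E i)) [∀ i, IsProbabilityMeasure (μ i)]
    {f : (∀ i, E i) → ℝ≥0∞} (hf : Measurable f) (i : ι) {B : ℝ≥0∞}
    (h : ∀ x, ∫⁻ y, f (Function.update x i y) ∂(μ i) ≤ B) :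
    ∫⁻ x, f x ∂(Measure.pi μ) ≤ B := by
  have hle : ∫⁻ x, f x ∂(Measure.pi μ) ≤ ∫⁻ _, B ∂(Measure.pi μ) := by
    refine lintegral_le_of_lmarginal_le {i} hf measurable_const fun x => ?_
    rw [lmarginal_singleton, lmarginal_singleton]
    simpa using h x
  simpa using hle

/-! ### The Laplace distribution -/

/-- The moment generating function of the Laplace distribution. -/
theorem lintegral_exp_laplace {b s : ℝ} (hb : 0 < b) (hs : |s| * b < 1) :
    ∫⁻ x, ENNReal.ofReal (Real.exp (s * x)) ∂(laplace b) =
      ENNReal.ofReal (1 / (1 - s ^ 2 * b ^ 2)) := by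
  have hs1 : s * b < 1 := lt_of_le_of_lt (by gcongr; exact le_abs_self s) hs
  have hs2 : -s * b < 1 := lt_of_le_of_lt (by gcongr; exact neg_le_abs s) hs
  have hp : 0 < s + 1 / b := by
    have : s + 1 / b = (s * b + 1) / b := by field_simp
    rw [this]; exact div_pos (by linarith) hb
  have hn : s - 1 / b < 0 := by
    have : s - 1 / b = (s * b - 1) / b := by field_simp
    rw [this]; exact div_neg_of_neg_of_pos (by linarith) hb
  set g : ℝ → ℝ := fun x => 1 / (2 * b) * Real.exp (-|x| / b) * Real.exp (s * x) with hg
  have e1 : Set.EqOn g (fun x => 1 / (2 * b) * Real.exp ((s + 1 / b) * x)) (Set.Iic 0) := by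
    intro x hx
    simp only [hg]
    rw [mul_assoc, ← Real.exp_add, abs_of_nonpos hx]
    congr 2; ring
  have e2 : Set.EqOn g (fun x => 1 / (2 * b) * Real.exp ((s - 1 / b) * x)) (Set.Ioi 0) := by
    intro x hx
    simp only [hg]
    rw [mul_assoc, ← Real.exp_add, abs_of_pos hx]
    congr 2; ring
  have i1 : IntegrableOn g (Set.Iic 0) :=
    (integrableOn_congr_fun e1 measurableSet_Iic).2 ((integrableOn_exp_mul_Iic hp 0).const_mul _)
  have i2 : IntegrableOn g (Set.Ioi 0) :=
    (integrableOn_congr_fun e2 measurableSet_Ioi).2 ((integrableOn_exp_mul_Ioi hn 0).const_mul _)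
  have hi : Integrable g := by
    rw [← integrableOn_univ, ← Set.Iic_union_Ioi (a := (0 : ℝ))]
    exact i1.union i2
  have hint : ∫ x, g x = 1 / (1 - s ^ 2 * b ^ 2) := by
    rw [← setIntegral_univ, ← Set.Iic_union_Ioi (a := (0 : ℝ)),
      setIntegral_union (Set.Iic_disjoint_Ioi le_rfl) measurableSet_Ioi i1 i2,
      setIntegral_congr_fun measurableSet_Iic e1, setIntegral_congr_fun measurableSet_Ioi e2,
      integral_const_mul, integral_const_mul, integral_exp_mul_Iic hp, integral_exp_mul_Ioi hn]
    have h1 : 1 - s ^ 2 * b ^ 2 ≠ 0 := by nlinarith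
    have h2 : s * b + 1 ≠ 0 := by linarith
    have h3 : s * b - 1 ≠ 0 := by linarith
    have h6 : 1 - s ^ 2 * b ^ 2 = -((s * b + 1) * (s * b - 1)) := by ring
    have h4 : s + 1 / b = (s * b + 1) / b := by field_simp
    have h5 : s - 1 / b = (s * b - 1) / b := by field_simp
    rw [h4, h5, h6]
    simp only [mul_zero, Real.exp_zero]
    generalize s * b = u at h2 h3 ⊢
    field_simp
    ring
  rw [laplace, lintegral_withDensity_eq_lintegral_mul _ (by fun_prop) (by fun_prop), ← hint,
    ofReal_integral_eq_lintegral_ofReal hi (.of_forall fun x => by positivity)]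
  refine lintegral_congr fun x => ?_
  rw [Pi.mul_apply, ← ENNReal.ofReal_mul (by positivity)]

theorem isProbabilityMeasure_laplace {b : ℝ} (hb : 0 < b) : IsProbabilityMeasure (laplace b) :=
  ⟨by simpa using lintegral_exp_laplace (s := 0) hb (by simp)⟩

theorem integrable_exp_laplace {b s : ℝ} (hb : 0 < b) (hs : |s| * b < 1) :
    Integrable (fun x => Real.exp (s * x)) (laplace b) := by
  refine ⟨by fun_prop, ?_⟩
  rw [hasFiniteIntegral_iff_ofReal (.of_forall fun x => (Real.exp_pos _).le),
    lintegral_exp_laplace hb hs]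
  exact ENNReal.ofReal_lt_top

theorem integrable_id_laplace {b : ℝ} (hb : 0 < b) : Integrable (fun x => x) (laplace b) := by
  have h1 : Integrable (fun x => Real.exp (1 / (2 * b) * x)) (laplace b) :=
    integrable_exp_laplace hb (by rw [abs_of_pos (by positivity)]; field_simp; norm_num)
  have h2 : Integrable (fun x => Real.exp (-(1 / (2 * b)) * x)) (laplace b) :=
    integrable_exp_laplace hb (by rw [abs_neg, abs_of_pos (by positivity)]; field_simp; norm_num)
  refine ((h1.add h2).const_mul (2 * b)).mono' (by fun_prop) (.of_forall fun x => ?_)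
  have hx : x = 2 * b * (1 / (2 * b) * x) := by field_simp
  have e1 := Real.add_one_le_exp (1 / (2 * b) * x)
  have e2 := Real.add_one_le_exp (-(1 / (2 * b)) * x)
  have p1 := Real.exp_pos (1 / (2 * b) * x)
  have p2 := Real.exp_pos (-(1 / (2 * b)) * x)
  simp only [Pi.add_apply, Real.norm_eq_abs]
  calc |x| = 2 * b * |1 / (2 * b) * x| := by
        conv_lhs => rw [hx, abs_mul, abs_of_pos (show 0 < 2 * b by positivity)]
    _ ≤ _ := by
        gcongr
        exact abs_le.2 ⟨by linarith, by linarith⟩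

/-- The Laplace distribution is symmetric, hence centred. -/
theorem integral_id_laplace (b : ℝ) : ∫ x, x ∂(laplace b) = 0 := by
  have h : ∫ x, x ∂(laplace b) = - ∫ x, x ∂(laplace b) := by
    rw [← integral_neg, laplace, integral_withDensity_eq_integral_toReal_smul (by fun_prop)
      (.of_forall fun x => ENNReal.ofReal_lt_top),
      integral_withDensity_eq_integral_toReal_smul (by fun_prop)
      (.of_forall fun x => ENNReal.ofReal_lt_top),
      ← integral_neg_eq_self]
    simp
  linarith

/-- A translate of the Laplace distribution has an explicit density. -/
theorem map_add_laplace (b a : ℝ) :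
    (laplace b).map (· + a) =
      (laplace b).withDensity fun x => ENNReal.ofReal (Real.exp ((|x| - |x - a|) / b)) := by
  refine Measure.ext_of_lintegral _ fun f hf => ?_
  rw [lintegral_map hf (by fun_prop), lintegral_withDensity_eq_lintegral_mul _ (by fun_prop) hf,
    laplace, lintegral_withDensity_eq_lintegral_mul _ (by fun_prop) (by fun_prop),
    lintegral_withDensity_eq_lintegral_mul _ (by fun_prop) (by fun_prop),
    ← lintegral_sub_right_eq_self _ a]
  refine lintegral_congr fun x => ?_
  simp only [Pi.mul_apply, sub_add_cancel]
  rw [← mul_assoc]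
  congr 1
  by_cases hb : 0 ≤ b
  · rw [← ENNReal.ofReal_mul (by positivity), mul_assoc, ← Real.exp_add]
    congr 3; ring
  · have hb : 1 / (2 * b) < 0 := by rw [one_div_neg]; linarith
    rw [ENNReal.ofReal_of_nonpos, ENNReal.ofReal_of_nonpos, zero_mul] <;>
      exact mul_nonpos_of_nonpos_of_nonneg hb.le (Real.exp_pos _).le

/-! ### Privacy of the Laplace mechanism -/

/-- The mean of a privacy loss that is bounded by `r` is at most `r² / 2`: Hoeffding's lemma
bounds the moment generating function at `-1`, which equals `1`. -/
theorem integral_le_of_integral_exp_neg {Ω : Type*} [MeasurableSpace Ω] (μ : Measure Ω)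
    [IsProbabilityMeasure μ] {Z : Ω → ℝ} {r : NNReal} (hZ : Measurable Z) (hr : ∀ ω, |Z ω| ≤ r)
    (h1 : ∫ ω, Real.exp (-Z ω) ∂μ = 1) :
    HasSubgaussianMGF (fun ω => Z ω - ∫ ω, Z ω ∂μ) (r ^ 2) μ ∧ ∫ ω, Z ω ∂μ ≤ r ^ 2 / 2 := by
  have hs := hasSubgaussianMGF_of_mem_Icc (μ := μ) (a := -r) (b := r) hZ.aemeasurable
    (.of_forall fun ω => abs_le.1 (hr ω))
  have hr2 : (‖(r : ℝ) - -r‖₊ / 2) = r := by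
    ext
    simp only [NNReal.coe_div, coe_nnnorm, Real.norm_eq_abs, NNReal.coe_ofNat]
    rw [abs_of_nonneg (by simp)]; ring
  rw [hr2] at hs
  refine ⟨hs, ?_⟩
  have hm := hs.mgf_le (-1)
  have : mgf (fun ω => Z ω - ∫ ω, Z ω ∂μ) μ (-1) = Real.exp (∫ ω, Z ω ∂μ) := by
    rw [mgf]
    have : ∀ ω, Real.exp (-1 * (Z ω - ∫ ω, Z ω ∂μ)) =
        Real.exp (∫ ω, Z ω ∂μ) * Real.exp (-Z ω) := fun ω => by
      rw [← Real.exp_add]; congr 1; ring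
    simp_rw [this]
    rw [integral_const_mul, h1, mul_one]
  rw [this, Real.exp_le_exp] at hm
  simpa using hm

/-- Releasing `K` numbers, each of sensitivity `r * b`, with independent Laplace noise of scale `b`
is `(ε, δ)`-differentially private as soon as the Gaussian tail of the privacy loss is at most
`δ`. -/
theorem laplace_shift_le {K : ℕ} {b ε δ : ℝ} {r : NNReal} (hb : 0 < b) (hδ : 0 < δ)
    (hr : 0 < r) (hK : 0 < K) (hε : (K : ℝ) * r ^ 2 / 2 ≤ ε)
    (htail : 2 * K * r ^ 2 * Real.log (1 / δ) ≤ (ε - K * r ^ 2 / 2) ^ 2)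
    {a : Fin K → ℝ} (ha : ∀ j, |a j| ≤ r * b) {U : Set (Fin K → ℝ)} (hU : MeasurableSet U) :
    (Measure.pi fun _ : Fin K => laplace b) {l | (fun j => l j + a j) ∈ U} ≤
      ENNReal.ofReal (Real.exp ε) * (Measure.pi fun _ : Fin K => laplace b) U +
        ENNReal.ofReal δ := by
  have := isProbabilityMeasure_laplace hb
  set ν := Measure.pi fun _ : Fin K => laplace b with hν
  -- the privacy loss of one coordinate, in terms of the noise
  set Z : Fin K → ℝ → ℝ := fun j x => (|x + a j| - |x|) / b with hZdef
  have hZm : ∀ j, Measurable (Z j) := fun j => by fun_prop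
  have hZb : ∀ j x, |Z j x| ≤ r := fun j x => by
    simp only [hZdef]
    rw [abs_div, abs_of_pos hb, div_le_iff₀ hb]
    refine le_trans ?_ (ha j)
    simpa using abs_abs_sub_abs_le_abs_sub (x + a j) x
  have hZ1 : ∀ j, ∫ x, Real.exp (-Z j x) ∂(laplace b) = 1 := fun j => by
    rw [integral_eq_lintegral_of_nonneg_ae (.of_forall fun x => (Real.exp_pos _).le)
      (by fun_prop)]
    have h := congrArg (fun m => m Set.univ) (map_add_laplace b (-a j))
    simp only [withDensity_apply _ MeasurableSet.univ, Measure.restrict_univ,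
      Measure.map_apply (measurable_add_const (-a j)) MeasurableSet.univ, Set.preimage_univ,
      measure_univ] at h
    have h2 : ∀ x, -Z j x = (|x| - |x - -a j|) / b := fun x => by
      simp only [hZdef, sub_neg_eq_add]; ring
    simp_rw [h2, ← h, ENNReal.toReal_one]
  have hsub := fun j => integral_le_of_integral_exp_neg (laplace b) (hZm j) (hZb j) (hZ1 j)
  have hshift : ν.map (fun l j => l j + a j) =
      ν.withDensity fun x => ∏ j, ENNReal.ofReal (Real.exp ((|x j| - |x j - a j|) / b)) := by
    have hprob : ∀ j, IsProbabilityMeasure ((laplace b).map (· + a j)) := fun j =>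
      Measure.isProbabilityMeasure_map (by fun_prop)
    have hsig : ∀ j, SigmaFinite ((laplace b).withDensity fun x =>
        ENNReal.ofReal (Real.exp ((|x| - |x - a j|) / b))) := fun j => by
      rw [← map_add_laplace]; infer_instance
    rw [hν, ← pi_withDensity (fun _ : Fin K => laplace b)
      (f := fun j x => ENNReal.ofReal (Real.exp ((|x| - |x - a j|) / b))) fun j => by fun_prop]
    simp_rw [← map_add_laplace]
    exact Measure.pi_map_pi (μ := fun _ : Fin K => laplace b) (f := fun j x => x + a j)
      fun j => by fun_prop
  have hmeas : Measurable fun (l : Fin K → ℝ) j => l j + a j := by fun_prop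
  set V : Set (Fin K → ℝ) := {x | ∑ j, (|x j| - |x j - a j|) / b ≤ ε} with hV
  have hVm : MeasurableSet V := measurableSet_le (by fun_prop) (by fun_prop)
  have hmap : ν {l | (fun j => l j + a j) ∈ U} = ν.map (fun l j => l j + a j) U :=
    (Measure.map_apply hmeas hU).symm
  have hA : ν.map (fun l j => l j + a j) (U ∩ V) ≤ ENNReal.ofReal (Real.exp ε) * ν U := by
    rw [hshift, withDensity_apply _ (hU.inter hVm)]
    calc _ ≤ ∫⁻ _ in U ∩ V, ENNReal.ofReal (Real.exp ε) ∂ν := by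
          refine setLIntegral_mono (by fun_prop) fun x hx => ?_
          rw [← ENNReal.ofReal_prod_of_nonneg fun j _ => (Real.exp_pos _).le, ← Real.exp_sum]
          exact ENNReal.ofReal_le_ofReal (Real.exp_le_exp.2 hx.2)
      _ ≤ _ := by
          rw [setLIntegral_const]
          gcongr
          exact Set.inter_subset_left
  have hB : ν.map (fun l j => l j + a j) Vᶜ ≤ ENNReal.ofReal δ := by
    rw [Measure.map_apply hmeas hVm.compl]
    set E : Fin K → ℝ := fun j => ∫ x, Z j x ∂(laplace b) with hE
    have hindep : iIndepFun (fun j (l : Fin K → ℝ) => Z j (l j) - E j) ν :=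
      iIndepFun_pi (μ := fun _ : Fin K => laplace b) (X := fun j x => Z j x - E j)
        fun j => ((hZm j).sub_const _).aemeasurable
    have hsG : ∀ j ∈ Finset.univ,
        HasSubgaussianMGF (fun l : Fin K → ℝ => Z j (l j) - E j) (r ^ 2) ν := fun j _ => by
      have hp := measurePreserving_eval (fun _ : Fin K => laplace b) j
      exact HasSubgaussianMGF.of_map (Y := fun l : Fin K → ℝ => l j)
        (X := fun x => Z j x - E j) hp.measurable.aemeasurable (by rw [hp.map_eq]; exact (hsub j).1)
    have hES : ∑ j, E j ≤ K * r ^ 2 / 2 := by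
      calc ∑ j, E j ≤ ∑ _j : Fin K, (r : ℝ) ^ 2 / 2 := Finset.sum_le_sum fun j _ => (hsub j).2
        _ = _ := by simp; ring
    have hH := HasSubgaussianMGF.measure_sum_ge_le_of_iIndepFun hindep hsG
      (ε := ε - K * r ^ 2 / 2) (by linarith)
    have hincl : (fun (l : Fin K → ℝ) j => l j + a j) ⁻¹' Vᶜ ⊆
        {l | ε - K * r ^ 2 / 2 ≤ ∑ j, (Z j (l j) - E j)} := by
      intro l hl
      have hl' : ε < ∑ j, Z j (l j) := by simpa [hV, hZdef] using hl
      simp only [Set.mem_ofPred_eq, Finset.sum_sub_distrib]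
      linarith
    refine (measure_mono hincl).trans ?_
    rw [← ENNReal.ofReal_toReal (measure_ne_top ν _)]
    refine ENNReal.ofReal_le_ofReal (hH.trans ?_)
    rw [← Real.le_log_iff_exp_le hδ]
    have hKr : 0 < (K : ℝ) * r ^ 2 := by positivity
    push_cast
    simp only [Finset.sum_const, Finset.card_univ, Fintype.card_fin, nsmul_eq_mul]
    rw [div_le_iff₀ (by positivity)]
    rw [one_div, Real.log_inv] at htail
    linarith
  calc ν {l | (fun j => l j + a j) ∈ U} = ν.map (fun l j => l j + a j) U := hmap
    _ ≤ ν.map (fun l j => l j + a j) (U ∩ V) + ν.map (fun l j => l j + a j) Vᶜ := by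
        refine (measure_mono ?_).trans (measure_union_le _ _)
        intro x hx
        by_cases h : x ∈ V
        · exact Or.inl ⟨hx, h⟩
        · exact Or.inr h
    _ ≤ _ := add_le_add hA hB

end ProductAndPrivacy

/-! ### Clipping -/

section Clipping

variable {M K T : ℕ} {p : Fin K → Fin M → ℝ}

/-- A label has enough cells for its mass per cell to be at most `1 / M`. -/
theorem mul_le_cellCount (p : Fin K → Fin M → ℝ) (j : Fin K) (y : Fin M) :
    M * p j y ≤ cellCount p y :=
  (mul_le_mul_of_nonneg_left (le_ciSup (Set.finite_range fun j => p j y).bddAbove j)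
    (Nat.cast_nonneg M)).trans (Nat.le_ceil _)

theorem eq_zero_of_cellCount_eq_zero (hp : ∀ j, p j ∈ stdSimplex ℝ (Fin M)) (j : Fin K)
    {y : Fin M} (h : cellCount p y = 0) : p j y = 0 := by
  have h1 := mul_le_cellCount p j y
  rw [h, Nat.cast_zero] at h1
  have hM : (0 : ℝ) < M := by exact_mod_cast y.pos
  exact le_antisymm (by nlinarith) ((hp j).1 y)

theorem sum_cell (g : Fin M → ℝ) : ∑ c : Cell p, g c.1 = ∑ y, cellCount p y * g y := by
  simp [Fintype.sum_sigma]

theorem card_cell : (Fintype.card (Cell p) : ℝ) = ∑ y, (cellCount p y : ℝ) := by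
  simp

theorem le_card_cell (hp : ∀ j, p j ∈ stdSimplex ℝ (Fin M)) (hK : 0 < K) :
    (M : ℝ) ≤ Fintype.card (Cell p) := by
  rw [card_cell]
  calc (M : ℝ) = ∑ y, M * p ⟨0, hK⟩ y := by rw [← Finset.mul_sum, (hp _).2, mul_one]
    _ ≤ _ := Finset.sum_le_sum fun y _ => mul_le_cellCount p _ y

theorem card_cell_pos (hp : ∀ j, p j ∈ stdSimplex ℝ (Fin M)) (hK : 0 < K) (hM : 0 < M) :
    (0 : ℝ) < Fintype.card (Cell p) :=
  (Nat.cast_pos.2 hM).trans_le (le_card_cell hp hK)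

/-- The number of cells is at most `K + 1` times the reciprocal of the bound `1 / M` on the mass of a
cell. This is why the bounds on likelihood ratios do not depend on `M`. -/
theorem card_cell_le (hp : ∀ j, p j ∈ stdSimplex ℝ (Fin M)) (hK : 0 < K) :
    (Fintype.card (Cell p) : ℝ) ≤ M * (K + 1) := by
  have : Nonempty (Fin K) := ⟨⟨0, hK⟩⟩
  rw [card_cell]
  calc ∑ y, (cellCount p y : ℝ) ≤ ∑ y, (M * ∑ j, p j y + 1) := by
        refine Finset.sum_le_sum fun y _ => ?_
        have h0 : 0 ≤ ⨆ j, p j y := Real.iSup_nonneg fun j => (hp j).1 y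
        refine (Nat.ceil_lt_add_one (by positivity)).le.trans ?_
        gcongr
        exact ciSup_le fun j =>
          Finset.single_le_sum (f := fun j => p j y) (fun i _ => (hp i).1 y) (Finset.mem_univ j)
    _ = M * ∑ j, ∑ y, p j y + M := by
        rw [Finset.sum_add_distrib, ← Finset.mul_sum, Finset.sum_comm]; simp
    _ = M * (K + 1) := by
        simp only [(hp _).2]; simp; ring

theorem one_sub_inv_nonneg (hT : 0 < T) : 0 ≤ 1 - 1 / (T : ℝ) := by
  have h : 1 / (T : ℝ) ≤ 1 := by
    rw [div_le_one (by positivity)]; exact_mod_cast hT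
  linarith

theorem clipProb_nonneg (hT : 0 < T) (y : Fin M) (c : Cell p) : 0 ≤ clipProb T p y c := by
  unfold clipProb
  refine add_nonneg (mul_nonneg (one_sub_inv_nonneg hT) ?_) (by positivity)
  split_ifs <;> positivity

theorem sum_clipProb (hp : ∀ j, p j ∈ stdSimplex ℝ (Fin M)) (hK : 0 < K) (hM : 0 < M)
    (hT : 0 < T) (y : Fin M) : ∑ c, clipProb T p y c = 1 := by
  have hN := card_cell_pos hp hK hM
  have hT' : (0 : ℝ) < T := by exact_mod_cast hT
  have h1 : ∑ c : Cell p, (if cellCount p y = 0 then 1 / (Fintype.card (Cell p) : ℝ)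
        else if c.1 = y then 1 / (cellCount p y : ℝ) else 0) = 1 := by
    by_cases h : cellCount p y = 0
    · simp only [h, if_true, Finset.sum_const, Finset.card_univ, nsmul_eq_mul]
      field_simp
    · simp only [h, if_false]
      rw [sum_cell fun y' => if y' = y then 1 / (cellCount p y : ℝ) else 0]
      simp [h]
  simp only [clipProb]
  rw [Finset.sum_add_distrib, ← Finset.mul_sum, h1, Finset.sum_const, Finset.card_univ,
    nsmul_eq_mul]
  field_simp
  ring

/-- All cells of a label are equally likely. A label without cells contributes nothing, since its
probability is zero. -/
theorem clipped_eq (hp : ∀ j, p j ∈ stdSimplex ℝ (Fin M)) (j : Fin K) (c : Cell p) :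
    clipped T p j c = (1 - 1 / (T : ℝ)) * (p j c.1 / cellCount p c.1) +
      1 / ((T : ℝ) * Fintype.card (Cell p)) := by
  have hc : cellCount p c.1 ≠ 0 := fun h => (h ▸ c.2).elim0
  have h1 : ∀ y, clipProb T p y c * p j y =
      (1 - 1 / (T : ℝ)) * (if c.1 = y then 1 / (cellCount p y : ℝ) * p j y else 0) +
        1 / ((T : ℝ) * Fintype.card (Cell p)) * p j y := fun y => by
    unfold clipProb
    by_cases h : cellCount p y = 0
    · rw [eq_zero_of_cellCount_eq_zero hp j h]; simp
    · rw [if_neg h]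
      split_ifs <;> ring
  simp only [clipped, h1]
  rw [Finset.sum_add_distrib, ← Finset.mul_sum, ← Finset.mul_sum, (hp j).2,
    Finset.sum_ite_eq Finset.univ c.1, if_pos (Finset.mem_univ _)]
  ring

theorem sum_clipped (hp : ∀ j, p j ∈ stdSimplex ℝ (Fin M)) (hK : 0 < K) (hM : 0 < M)
    (hT : 0 < T) (j : Fin K) : ∑ c, clipped T p j c = 1 := by
  simp only [clipped]
  rw [Finset.sum_comm]
  simp only [← Finset.sum_mul, sum_clipProb hp hK hM hT, one_mul, (hp j).2]

theorem div_cellCount_le (hM : 0 < M) (j : Fin K) (y : Fin M) :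
    p j y / cellCount p y ≤ 1 / M := by
  by_cases h : cellCount p y = 0
  · rw [h]; simp
  · have hM' : (0 : ℝ) < M := by exact_mod_cast hM
    have : (0 : ℝ) < cellCount p y := by positivity
    rw [div_le_div_iff₀ this hM', one_mul, mul_comm]
    exact mul_le_cellCount p j y

theorem le_clipped (hp : ∀ j, p j ∈ stdSimplex ℝ (Fin M)) (hT : 0 < T) (j : Fin K)
    (c : Cell p) : 1 / ((T : ℝ) * Fintype.card (Cell p)) ≤ clipped T p j c := by
  rw [clipped_eq hp]
  have := (hp j).1 c.1
  have := one_sub_inv_nonneg hT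
  have : 0 ≤ (1 - 1 / (T : ℝ)) * (p j c.1 / cellCount p c.1) := by positivity
  linarith

theorem clipped_pos (hp : ∀ j, p j ∈ stdSimplex ℝ (Fin M)) (hK : 0 < K) (hM : 0 < M)
    (hT : 0 < T) (j : Fin K) (c : Cell p) : 0 < clipped T p j c := by
  have := card_cell_pos hp hK hM
  have hT' : (0 : ℝ) < T := by exact_mod_cast hT
  exact lt_of_lt_of_le (by positivity) (le_clipped hp hT j c)

theorem clipped_le' (hp : ∀ j, p j ∈ stdSimplex ℝ (Fin M)) (hM : 0 < M)
    (hT : 0 < T) (j : Fin K) (c : Cell p) :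
    clipped T p j c ≤ (1 - 1 / (T : ℝ)) * (1 / M) + 1 / ((T : ℝ) * Fintype.card (Cell p)) := by
  rw [clipped_eq hp]
  exact add_le_add (mul_le_mul_of_nonneg_left (div_cellCount_le hM j c.1)
    (one_sub_inv_nonneg hT)) le_rfl

theorem clipped_le (hp : ∀ j, p j ∈ stdSimplex ℝ (Fin M)) (hK : 0 < K) (hM : 0 < M)
    (hT : 0 < T) (j : Fin K) (c : Cell p) : clipped T p j c ≤ 1 / M := by
  have hN := le_card_cell hp hK
  have hM' : (0 : ℝ) < M := by exact_mod_cast hM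
  have hT' : (0 : ℝ) < T := by exact_mod_cast hT
  calc _ ≤ _ := clipped_le' hp hM hT j c
    _ ≤ (1 - 1 / (T : ℝ)) * (1 / M) + 1 / ((T : ℝ) * M) := by gcongr
    _ = 1 / M := by field_simp; ring

/-- The clipped likelihoods, multiplied by `M`, are at least `1 / ((K + 1) T)`. -/
theorem neg_log_le_log_clipped (hp : ∀ j, p j ∈ stdSimplex ℝ (Fin M)) (hK : 0 < K) (hM : 0 < M)
    (hT : 0 < T) (j : Fin K) (c : Cell p) :
    -Real.log ((K + 1) * T) ≤ Real.log (clipped T p j c) + Real.log M := by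
  have hM' : (0 : ℝ) < M := by exact_mod_cast hM
  have hT' : (0 : ℝ) < T := by exact_mod_cast hT
  have hN := card_cell_pos hp hK hM
  have hc := clipped_pos hp hK hM hT j c
  rw [← Real.log_mul hc.ne' hM'.ne', ← Real.log_inv]
  refine Real.log_le_log (by positivity) ?_
  calc ((K + 1) * (T : ℝ))⁻¹ = 1 / (T * (M * (K + 1))) * M := by field_simp
    _ ≤ 1 / ((T : ℝ) * Fintype.card (Cell p)) * M := by
        gcongr
        exact card_cell_le hp hK
    _ ≤ _ := by
        gcongr
        exact le_clipped hp hT j c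

theorem log_clipped_add_le (hp : ∀ j, p j ∈ stdSimplex ℝ (Fin M)) (hK : 0 < K) (hM : 0 < M)
    (hT : 0 < T) (j : Fin K) (c : Cell p) :
    Real.log (clipped T p j c) + Real.log M ≤ 0 := by
  have hM' : (0 : ℝ) < M := by exact_mod_cast hM
  have hc := clipped_pos hp hK hM hT j c
  rw [← Real.log_mul hc.ne' hM'.ne']
  refine Real.log_nonpos (by positivity) ?_
  have := clipped_le hp hK hM hT j c
  rwa [le_div_iff₀ hM'] at this

/-- The sensitivity of a log-likelihood. The number of cells can slightly exceed `M * K`, so that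
`log (K * T)` itself is not a bound. -/
theorem log_clipped_sub_le (hp : ∀ j, p j ∈ stdSimplex ℝ (Fin M)) (hK : 2 ≤ K) (hM : 0 < M)
    (hT : 0 < T) (j : Fin K) (c c' : Cell p) :
    Real.log (clipped T p j c) - Real.log (clipped T p j c') ≤ 4 / 3 * Real.log (K * T) := by
  have hK0 : 0 < K := by omega
  have hM' : (0 : ℝ) < M := by exact_mod_cast hM
  have hT' : (1 : ℝ) ≤ T := by exact_mod_cast hT
  have hK' : (2 : ℝ) ≤ K := by exact_mod_cast hK
  have hN := card_cell_pos hp hK0 hM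
  have hc := clipped_pos hp hK0 hM hT j c
  have hc' := clipped_pos hp hK0 hM hT j c'
  have hratio : clipped T p j c / clipped T p j c' ≤ 1 + (T - 1) * (K + 1) := by
    rw [div_le_iff₀ hc']
    have hA : (0 : ℝ) ≤ 1 + (T - 1) * (K + 1) := by
      have : (0 : ℝ) ≤ (T - 1) * (K + 1) := mul_nonneg (by linarith) (by linarith)
      linarith
    calc _ ≤ _ := clipped_le' hp hM hT j c
      _ = (1 + (T - 1) * (Fintype.card (Cell p) / M)) *
          (1 / ((T : ℝ) * Fintype.card (Cell p))) := by field_simp; ring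
      _ ≤ (1 + (T - 1) * (K + 1)) * (1 / ((T : ℝ) * Fintype.card (Cell p))) := by
          have h1 : (Fintype.card (Cell p) : ℝ) / M ≤ K + 1 := by
            rw [div_le_iff₀ hM', mul_comm]; exact card_cell_le hp hK0
          have h2 : (0 : ℝ) ≤ T - 1 := by linarith
          gcongr
      _ ≤ _ := by
          gcongr
          exact le_clipped hp hT j c'
  have hpow : (clipped T p j c / clipped T p j c') ^ 3 ≤ ((K : ℝ) * T) ^ 4 := by
    refine (pow_le_pow_left₀ (by positivity) hratio 3).trans ?_
    rcases Nat.eq_or_lt_of_le hT with h1 | h2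
    · rw [← h1]
      simpa using one_le_pow₀ (by linarith : (1 : ℝ) ≤ K)
    · have hT2 : (2 : ℝ) ≤ T := by exact_mod_cast h2
      have hx : (4 : ℝ) ≤ K * T := by nlinarith
      have hle : 1 + ((T : ℝ) - 1) * (K + 1) ≤ 3 / 2 * (K * T) := by nlinarith
      have h0 : 0 ≤ 1 + ((T : ℝ) - 1) * (K + 1) := by nlinarith
      calc _ ≤ (3 / 2 * ((K : ℝ) * T)) ^ 3 := pow_le_pow_left₀ h0 hle 3
        _ = 27 / 8 * (K * T : ℝ) ^ 3 := by ring
        _ ≤ (K * T) * (K * T : ℝ) ^ 3 := by gcongr; linarith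
        _ = _ := by ring
  have h := Real.log_le_log (by positivity) hpow
  rw [Real.log_pow, Real.log_pow, Real.log_div hc.ne' hc'.ne'] at h
  push_cast at h
  linarith

end Clipping

/-! ### From clipped to unclipped relative entropies -/

/-- Mixing `a` with a small multiple `τ u` changes `a * log (a / q)` by little from above, if the
likelihood ratios against `q` are bounded. -/
theorem mul_log_div_le_mix {τ a u q Λ : ℝ} (hτ : 0 < τ) (hτ1 : τ ≤ 1) (ha : 0 ≤ a) (hu : 0 < u)
    (hq : 0 < q) (h1 : -Λ ≤ Real.log (τ * u / q)) (h2 : 0 < a → Real.log (a / q) ≤ Λ) :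
    a * Real.log (a / q) - τ * (a * (1 + Λ) + u * Λ) ≤
      ((1 - τ) * a + τ * u) * Real.log (((1 - τ) * a + τ * u) / q) := by
  have h3 : 0 ≤ (1 - τ) * a := mul_nonneg (by linarith) ha
  have hP : 0 < (1 - τ) * a + τ * u := by positivity
  have hlog : -Λ ≤ Real.log (((1 - τ) * a + τ * u) / q) :=
    h1.trans (Real.log_le_log (by positivity) (by gcongr; linarith))
  have hu2 : -(τ * u * Λ) ≤ τ * u * Real.log (((1 - τ) * a + τ * u) / q) := by
    have := mul_le_mul_of_nonneg_left hlog (mul_pos hτ hu).le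
    linarith
  rcases ha.eq_or_lt with rfl | ha
  · simp only [zero_mul, mul_zero, zero_add, zero_sub] at hu2 ⊢
    linarith
  have h2 := h2 ha
  have h4 : (1 - τ) * a * Real.log (a / q) - τ * a ≤
      (1 - τ) * a * Real.log (((1 - τ) * a + τ * u) / q) := by
    rcases hτ1.eq_or_lt with rfl | hτ1
    · simp [ha.le]
    have h1τ : 0 < 1 - τ := by linarith
    have e1 : Real.log (1 - τ) + Real.log (a / q) ≤
        Real.log (((1 - τ) * a + τ * u) / q) := by
      rw [← Real.log_mul (by positivity) (by positivity)]
      refine Real.log_le_log (by positivity) ?_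
      rw [← mul_div_assoc]
      gcongr
      have := mul_pos hτ hu
      linarith
    have e2 := Real.one_sub_inv_le_log_of_pos h1τ
    have e3 : -τ ≤ (1 - τ) * Real.log (1 - τ) := by
      have := mul_le_mul_of_nonneg_left e2 h1τ.le
      rw [mul_sub, mul_inv_cancel₀ h1τ.ne'] at this
      linarith
    have e4 := mul_le_mul_of_nonneg_left e1 h3
    have e5 := mul_le_mul_of_nonneg_right e3 ha.le
    linarith
  have h5 : τ * a * Real.log (a / q) ≤ τ * a * Λ := by gcongr
  linarith

section KL

variable {M K T : ℕ} {p : Fin K → Fin M → ℝ}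

/-- The prediction is a probability vector, as a pushforward of a mixture of clipped
distributions. -/
theorem mixture_mem_stdSimplex (hp : ∀ j, p j ∈ stdSimplex ℝ (Fin M)) (hK : 0 < K) (hM : 0 < M)
    (hT : 0 < T) {w : Fin K → ℝ} (hw : w ∈ stdSimplex ℝ (Fin K)) :
    (fun y => ∑ i : Fin (cellCount p y), ∑ j, w j * clipped T p j ⟨y, i⟩) ∈
      stdSimplex ℝ (Fin M) := by
  refine ⟨fun y => Finset.sum_nonneg fun i _ => Finset.sum_nonneg fun j _ =>
    mul_nonneg (hw.1 j) (clipped_pos hp hK hM hT j _).le, ?_⟩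
  rw [← Fintype.sum_sigma (f := fun c : Cell p => ∑ j, w j * clipped T p j c), Finset.sum_comm]
  simp only [← Finset.mul_sum, sum_clipped hp hK hM hT, mul_one]
  exact hw.2

/-- The relative entropy of the prediction is bounded by the mean regret in logarithmic loss on
the clipped distributions, up to the cost of clipping. -/
theorem kl_mixture_le (hp : ∀ j, p j ∈ stdSimplex ℝ (Fin M)) (hK : 0 < K) (hM : 0 < M)
    (hT : 0 < T) {w : Fin K → ℝ} (hw : w ∈ stdSimplex ℝ (Fin K)) (k : Fin K) :
    ∃ r : ℝ, 0 ≤ r ∧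
      r ≤ ∑ c, clipped T p k c *
          (Real.log (clipped T p k c) - ∑ j, w j * Real.log (clipped T p j c)) +
        1 / T * (1 + 2 * Real.log ((K + 1) * T)) ∧
      kl (p k) (fun y => ∑ i : Fin (cellCount p y), ∑ j, w j * clipped T p j ⟨y, i⟩) =
        ENNReal.ofReal r := by
  set Λ := Real.log ((K + 1) * T) with hΛ
  set N : ℝ := (Fintype.card (Cell p) : ℝ) with hNdef
  set n : Fin M → ℝ := fun y => cellCount p y with hn
  have hM' : (0 : ℝ) < M := by exact_mod_cast hM
  have hT' : (1 : ℝ) ≤ T := by exact_mod_cast hT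
  have hN : 0 < N := card_cell_pos hp hK hM
  -- the clipped probabilities depend on the label only
  set P : Fin K → Fin M → ℝ := fun j y => (1 - 1 / (T : ℝ)) * (p j y / n y) + 1 / (T * N) with hP
  have hcl : ∀ j (c : Cell p), clipped T p j c = P j c.1 := fun j c => clipped_eq hp j c
  set Q : Fin M → ℝ := fun y => ∑ j, w j * P j y with hQ
  have hpred : ∀ y, ∑ i : Fin (cellCount p y), ∑ j, w j * clipped T p j ⟨y, i⟩ = n y * Q y :=
    fun y => by simp [hcl, hQ, hn]
  have hPpos : ∀ j y, 0 < P j y := fun j y => by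
    have := one_sub_inv_nonneg hT
    have := (hp j).1 y
    simp only [hP]
    positivity
  have hPge : ∀ j y, 1 / (T * N) ≤ P j y := fun j y => by
    have := one_sub_inv_nonneg hT
    have := (hp j).1 y
    have : 0 ≤ (1 - 1 / (T : ℝ)) * (p j y / n y) := by positivity
    simp only [hP]
    linarith
  have hPle : ∀ j y, P j y ≤ 1 / M := fun j y => by
    have h1 := one_sub_inv_nonneg hT
    calc P j y ≤ (1 - 1 / (T : ℝ)) * (1 / M) + 1 / (T * M) := by
          refine add_le_add (mul_le_mul_of_nonneg_left (div_cellCount_le hM j y) h1) ?_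
          have := le_card_cell hp hK
          gcongr
      _ = 1 / M := by field_simp; ring
  have hQge : ∀ y, 1 / (T * N) ≤ Q y := fun y => by
    calc 1 / (T * N) = ∑ j, w j * (1 / (T * N)) := by rw [← Finset.sum_mul, hw.2, one_mul]
      _ ≤ _ := Finset.sum_le_sum fun j _ => mul_le_mul_of_nonneg_left (hPge j y) (hw.1 j)
  have hQle : ∀ y, Q y ≤ 1 / M := fun y => by
    calc Q y ≤ ∑ j, w j * (1 / M : ℝ) :=
          Finset.sum_le_sum fun j _ => mul_le_mul_of_nonneg_left (hPle j y) (hw.1 j)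
      _ = _ := by rw [← Finset.sum_mul, hw.2, one_mul]
  have hQpos : ∀ y, 0 < Q y := fun y => lt_of_lt_of_le (by positivity) (hQge y)
  have hNle : N ≤ M * (K + 1) := card_cell_le hp hK
  have hΛ1 : Real.log (T * N / M) ≤ Λ := by
    refine Real.log_le_log (by positivity) ?_
    rw [div_le_iff₀ hM']
    calc T * N ≤ T * (M * (K + 1)) := by gcongr
      _ = _ := by ring
  have hn0 : ∀ y, n y = 0 → p k y = 0 := fun y h =>
    eq_zero_of_cellCount_eq_zero hp k (by simpa [hn] using h)
  have hnn : ∀ y, 0 ≤ n y := fun y => Nat.cast_nonneg _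
  have hfun : (fun y => ∑ i : Fin (cellCount p y), ∑ j, w j * clipped T p j ⟨y, i⟩) =
      fun y => n y * Q y := funext hpred
  have hsimp := mixture_mem_stdSimplex hp hK hM hT hw
  rw [hfun] at hsimp
  rw [hfun]
  refine ⟨∑ y, p k y * Real.log (p k y / (n y * Q y)), ?_, ?_, ?_⟩
  · -- Gibbs' inequality, from `log x ≥ 1 - 1/x`
    have hterm : ∀ y, p k y - n y * Q y ≤ p k y * Real.log (p k y / (n y * Q y)) := fun y => by
      rcases ((hp k).1 y).eq_or_lt with h | h
      · rw [← h]
        have := mul_nonneg (hnn y) (hQpos y).le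
        simpa using this
      · have hny : 0 < n y := lt_of_le_of_ne (hnn y) fun h0 => h.ne' (hn0 y h0.symm)
        have hq := mul_pos hny (hQpos y)
        have := mul_le_mul_of_nonneg_left
          (Real.one_sub_inv_le_log_of_pos (div_pos h hq)) h.le
        refine le_trans (le_of_eq ?_) this
        field_simp
    have hsum := Finset.sum_le_sum fun y (_ : y ∈ Finset.univ) => hterm y
    rw [Finset.sum_sub_distrib, (hp k).2, hsimp.2, sub_self] at hsum
    exact hsum
  · have hD : ∑ y, n y * (P k y * Real.log (P k y / Q y)) ≤ ∑ c, clipped T p k c *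
          (Real.log (clipped T p k c) - ∑ j, w j * Real.log (clipped T p j c)) := by
      simp only [hcl]
      rw [sum_cell fun y => P k y * (Real.log (P k y) - ∑ j, w j * Real.log (P j y))]
      refine Finset.sum_le_sum fun y _ => ?_
      refine mul_le_mul_of_nonneg_left (mul_le_mul_of_nonneg_left ?_ (hPpos k y).le) (hnn y)
      rw [Real.log_div (hPpos k y).ne' (hQpos y).ne']
      have := strictConcaveOn_log_Ioi.concaveOn.le_map_sum (t := Finset.univ) (w := w)
        (p := fun j => P j y) (fun j _ => hw.1 j) hw.2 fun j _ => hPpos j y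
      simp only [smul_eq_mul] at this
      linarith
    have hterm : ∀ y, p k y * Real.log (p k y / (n y * Q y)) -
        1 / T * (p k y * (1 + Λ) + n y / N * Λ) ≤ n y * (P k y * Real.log (P k y / Q y)) :=
        fun y => by
      by_cases hy : n y = 0
      · simp [hy, hn0 y hy]
      have hny : 0 < n y := lt_of_le_of_ne (hnn y) (Ne.symm hy)
      have hmix := mul_log_div_le_mix (τ := 1 / (T : ℝ)) (a := p k y / n y) (u := 1 / N)
        (q := Q y) (Λ := Λ) (by positivity) (by linarith [one_sub_inv_nonneg hT])
        (div_nonneg ((hp k).1 y) hny.le) (by positivity) (hQpos y) ?_ fun hpos => ?_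
      · have h2 := mul_le_mul_of_nonneg_left hmix hny.le
        have e1 : (1 - 1 / (T : ℝ)) * (p k y / n y) + 1 / T * (1 / N) = P k y := by
          simp only [hP]; rw [one_div_mul_one_div]
        rw [e1] at h2
        refine le_trans (le_of_eq ?_) h2
        rw [← div_div]
        field_simp
      · have : -Λ ≤ -Real.log (T * N / M) := by linarith
        refine this.trans ?_
        rw [← Real.log_inv]
        refine Real.log_le_log (by positivity) ?_
        rw [le_div_iff₀ (hQpos y)]
        calc (T * N / M)⁻¹ * Q y ≤ (T * N / M)⁻¹ * (1 / M) := by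
              gcongr; exact hQle y
          _ = 1 / T * (1 / N) := by field_simp
      · refine le_trans (Real.log_le_log (by have := hQpos y; positivity) ?_) hΛ1
        calc p k y / n y / Q y ≤ (1 / M) / (1 / (T * N)) :=
              div_le_div₀ (by positivity) (div_cellCount_le hM k y) (by positivity) (hQge y)
          _ = T * N / M := by field_simp
    have hsum := Finset.sum_le_sum fun y (_ : y ∈ Finset.univ) => hterm y
    have hnN : ∑ y, n y = N := card_cell.symm
    rw [Finset.sum_sub_distrib, ← Finset.mul_sum, Finset.sum_add_distrib, ← Finset.sum_mul,
      ← Finset.sum_mul, (hp k).2, ← Finset.sum_div, hnN, div_self hN.ne'] at hsum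
    have e : 1 / (T : ℝ) * (1 * (1 + Λ) + 1 * Λ) = 1 / T * (1 + 2 * Λ) := by ring
    rw [e] at hsum
    linarith
  · rw [kl, if_pos]
    intro y hy
    exact hn0 y ((mul_eq_zero.1 hy).resolve_right (hQpos y).ne')

end KL

/-! ### Exponential weights with random unbounded losses -/

section Hedge

variable {K T : ℕ}

theorem sum_mul_pos {ι : Type*} [Fintype ι] {w u : ι → ℝ} (hw : ∀ i, 0 ≤ w i)
    (hw1 : ∑ i, w i = 1) (hu : ∀ i, 0 < u i) : 0 < ∑ i, w i * u i := by
  obtain ⟨i, hi⟩ : ∃ i, 0 < w i := by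
    by_contra! h
    have := Finset.sum_nonpos fun i (_ : i ∈ Finset.univ) => h i
    linarith
  exact Finset.sum_pos' (fun i _ => mul_nonneg (hw i) (hu i).le)
    ⟨i, Finset.mem_univ i, mul_pos hi (hu i)⟩

theorem weight_pos (η : ℝ) {t : Fin T} (z : Set.Iio t → Fin K → ℝ) (j : Fin K) :
    0 < weight η z j :=
  Finset.prod_pos fun _ _ => Real.exp_pos _

theorem sum_weight_pos (hK : 0 < K) (η : ℝ) {t : Fin T} (z : Set.Iio t → Fin K → ℝ) :
    0 < ∑ i, weight η z i :=
  Finset.sum_pos (fun i _ => weight_pos η z i) ⟨⟨0, hK⟩, Finset.mem_univ _⟩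

theorem normWeight_mem_stdSimplex (hK : 0 < K) (η : ℝ) {t : Fin T}
    (z : Set.Iio t → Fin K → ℝ) : normWeight η z ∈ stdSimplex ℝ (Fin K) := by
  refine ⟨fun j => div_nonneg (weight_pos η z j).le (sum_weight_pos hK η z).le, ?_⟩
  simp only [normWeight]
  rw [← Finset.sum_div, div_self (sum_weight_pos hK η z).ne']

theorem measurable_normWeight (η : ℝ) {t : Fin T} (j : Fin K) :
    Measurable fun z : Set.Iio t → Fin K → ℝ => normWeight η z j := by
  unfold normWeight weight
  fun_prop

/-- The total weight after the rounds with index less than `n`. -/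
noncomputable def totalWeight (η : ℝ) (z : Fin T → Fin K → ℝ) (n : ℕ) : ℝ :=
  ∑ j, ∏ s with s.val < n, Real.exp (-η * z s j)

theorem weight_eq_prod_filter (η : ℝ) (z : Fin T → Fin K → ℝ) (t : Fin T) (j : Fin K) :
    weight η (fun s : Set.Iio t => z s) j =
      ∏ s with s.val < t.val, Real.exp (-η * z s j) :=
  (Finset.prod_subtype (p := fun s => s ∈ Set.Iio t) _ (fun s => by simp)
    fun s => Real.exp (-η * z s j)).symm

theorem totalWeight_pos (hK : 0 < K) (η : ℝ) (z : Fin T → Fin K → ℝ) (n : ℕ) :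
    0 < totalWeight η z n :=
  Finset.sum_pos (fun _ _ => Finset.prod_pos fun _ _ => Real.exp_pos _)
    ⟨⟨0, hK⟩, Finset.mem_univ _⟩

/-- The mean of the exponentiated loss under the current weights is the growth factor of the total
weight. -/
theorem sum_normWeight_mul_exp (η : ℝ) (z : Fin T → Fin K → ℝ) (t : Fin T) :
    ∑ j, normWeight η (fun s : Set.Iio t => z s) j * Real.exp (-η * z t j) =
      totalWeight η z (t + 1) / totalWeight η z t := by
  simp only [normWeight, weight_eq_prod_filter, totalWeight]
  rw [Finset.sum_div]
  refine Finset.sum_congr rfl fun j _ => ?_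
  have : Finset.univ.filter (fun s : Fin T => s.val < t.val + 1) =
      insert t (Finset.univ.filter fun s : Fin T => s.val < t.val) := by
    ext s
    simp only [Finset.mem_filter, Finset.mem_univ, true_and, Finset.mem_insert, Fin.ext_iff]
    omega
  rw [this, Finset.prod_insert (by simp)]
  ring

/-- The growth factors telescope, and the final total weight is at least the weight of the
comparator `k`. -/
theorem le_sum_log_sum_normWeight (hK : 0 < K) (η : ℝ) (z : Fin T → Fin K → ℝ) (k : Fin K) :
    -η * ∑ t, z t k - Real.log K ≤
      ∑ t : Fin T, Real.log
        (∑ j, normWeight η (fun s : Set.Iio t => z s) j * Real.exp (-η * z t j)) := by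
  have h0 : totalWeight η z 0 = K := by simp [totalWeight]
  have hT : Real.exp (-η * ∑ t, z t k) ≤ totalWeight η z T := by
    have : ∏ s with s.val < T, Real.exp (-η * z s k) = Real.exp (-η * ∑ t, z t k) := by
      rw [Finset.mul_sum, Real.exp_sum]; simp
    rw [← this]
    exact Finset.single_le_sum
      (f := fun j => ∏ s with s.val < T, Real.exp (-η * z s j))
      (fun j _ => Finset.prod_nonneg fun _ _ => (Real.exp_pos _).le) (Finset.mem_univ k)
  have hlog : ∀ t : Fin T, Real.log
      (∑ j, normWeight η (fun s : Set.Iio t => z s) j * Real.exp (-η * z t j)) =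
      (fun n : ℕ => Real.log (totalWeight η z (n + 1)) - Real.log (totalWeight η z n)) t :=
    fun t => by
      rw [sum_normWeight_mul_exp,
        Real.log_div (totalWeight_pos hK η z _).ne' (totalWeight_pos hK η z _).ne']
  rw [Finset.sum_congr rfl fun t _ => hlog t, Fin.sum_univ_eq_sum_range
    (fun n : ℕ => Real.log (totalWeight η z (n + 1)) - Real.log (totalWeight η z n)) T,
    Finset.sum_range_sub (fun n => Real.log (totalWeight η z n)), h0]
  have := Real.log_le_log (Real.exp_pos _) hT
  rw [Real.log_exp] at this
  linarith

/-- Exponential weights with independent random losses. The losses may be unbounded: only the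
exponential moments `A t j` of the losses and the mean `m t` of the loss of the comparator `k`
enter. If the cost `L t w` of playing the weights `w` is controlled by the gap between the
comparator's mean loss and the mixed cumulant `-log (∑ j, w j * A t j)`, then the expected
cumulative cost is controlled by `log K`. -/
theorem lintegral_sum_cost_le (hK : 0 < K) {η θ κ : ℝ} (hθ : 0 < θ)
    (ρ : Fin T → Measure (Fin K → ℝ)) [∀ t, IsProbabilityMeasure (ρ t)] (k : Fin K)
    {m : Fin T → ℝ} {A : Fin T → Fin K → ℝ} {L : Fin T → (Fin K → ℝ) → ℝ≥0∞}
    (hint : ∀ t, Integrable (fun z => z k) (ρ t)) (hm : ∀ t, ∫ z, z k ∂(ρ t) = m t)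
    (hA : ∀ t j, 0 < A t j)
    (hexp : ∀ t j, ∫⁻ z, ENNReal.ofReal (Real.exp (-η * z j)) ∂(ρ t) = ENNReal.ofReal (A t j))
    (hL : ∀ t, ∀ w ∈ stdSimplex ℝ (Fin K), ∃ r : ℝ, 0 ≤ r ∧
      θ * r ≤ -η * m t - Real.log (∑ j, w j * A t j) + κ ∧ L t w = ENNReal.ofReal r) :
    ∫⁻ z, ∑ t, L t (normWeight η fun s : Set.Iio t => z s) ∂(Measure.pi ρ) ≤
      ENNReal.ofReal ((T * κ + Real.log K) / θ) := by
  set W : Fin T → (Fin T → Fin K → ℝ) → Fin K → ℝ :=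
    fun t z => normWeight η fun s : Set.Iio t => z s with hW
  have hWs : ∀ t z, W t z ∈ stdSimplex ℝ (Fin K) := fun t z => normWeight_mem_stdSimplex hK η _
  have hWm : ∀ t j, Measurable fun z => W t z j := fun t j =>
    (measurable_normWeight η j).comp (by fun_prop)
  set a : Fin T → (Fin T → Fin K → ℝ) → ℝ := fun t z => ∑ j, W t z j * A t j with ha
  set g : Fin T → (Fin T → Fin K → ℝ) → ℝ :=
    fun t z => ∑ j, W t z j * Real.exp (-η * z t j) with hg
  have hapos : ∀ t z, 0 < a t z := fun t z => sum_mul_pos (hWs t z).1 (hWs t z).2 (hA t)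
  have hgpos : ∀ t z, 0 < g t z := fun t z => sum_mul_pos (hWs t z).1 (hWs t z).2
    fun j => Real.exp_pos _
  have ham : ∀ t, Measurable (a t) := fun t =>
    Finset.measurable_fun_sum _ fun j _ => (hWm t j).mul_const _
  have hgm : ∀ t, Measurable (g t) := fun t =>
    Finset.measurable_fun_sum _ fun j _ => (hWm t j).mul (by fun_prop)
  -- given the past, the growth factor `g` has mean `a`
  have hratio : ∀ t, ∫⁻ z, ENNReal.ofReal (g t z / a t z) ∂(Measure.pi ρ) ≤ 1 := fun t => by
    refine lintegral_pi_le_of_update ρ ((hgm t).div (ham t)).ennreal_ofReal t fun x => ?_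
    have hWu : ∀ y, W t (Function.update x t y) = W t x := fun y => by
      refine congrArg (normWeight η) (funext fun s => ?_)
      exact Function.update_of_ne (ne_of_lt s.2) _ _
    have e : ∀ y, ENNReal.ofReal (g t (Function.update x t y) / a t (Function.update x t y)) =
        ∑ j, ENNReal.ofReal (W t x j / a t x) * ENNReal.ofReal (Real.exp (-η * y j)) :=
        fun y => by
      simp only [hg, ha, hWu, Function.update_self]
      rw [Finset.sum_div, ENNReal.ofReal_sum_of_nonneg fun j _ => div_nonneg
        (mul_nonneg ((hWs t x).1 j) (Real.exp_pos _).le) (hapos t x).le]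
      refine Finset.sum_congr rfl fun j _ => ?_
      rw [← ENNReal.ofReal_mul (div_nonneg ((hWs t x).1 j) (hapos t x).le)]
      congr 1
      ring
    refine (lintegral_congr e).trans_le ?_
    rw [lintegral_finsetSum _ fun j _ => by fun_prop]
    have e2 : ∀ j, ∫⁻ y, ENNReal.ofReal (W t x j / a t x) *
        ENNReal.ofReal (Real.exp (-η * y j)) ∂(ρ t) =
        ENNReal.ofReal (W t x j * A t j / a t x) := fun j => by
      rw [lintegral_const_mul _ (by fun_prop), hexp,
        ← ENNReal.ofReal_mul (div_nonneg ((hWs t x).1 j) (hapos t x).le)]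
      congr 1
      ring
    simp_rw [e2]
    rw [← ENNReal.ofReal_sum_of_nonneg fun j _ =>
      div_nonneg (mul_nonneg ((hWs t x).1 j) (hA t j).le) (hapos t x).le, ← Finset.sum_div,
      div_self (hapos t x).ne', ENNReal.ofReal_one]
  have hratio_int : ∀ t, Integrable (fun z => g t z / a t z) (Measure.pi ρ) := fun t => by
    refine ⟨((hgm t).div (ham t)).aestronglyMeasurable, ?_⟩
    rw [hasFiniteIntegral_iff_ofReal (.of_forall fun z => (div_pos (hgpos t z) (hapos t z)).le)]
    exact (hratio t).trans_lt ENNReal.one_lt_top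
  have hratio_le : ∀ t, ∫ z, g t z / a t z ∂(Measure.pi ρ) ≤ 1 := fun t => by
    rw [integral_eq_lintegral_of_nonneg_ae
      (.of_forall fun z => (div_pos (hgpos t z) (hapos t z)).le)
      ((hgm t).div (ham t)).aestronglyMeasurable]
    exact ENNReal.toReal_le_of_le_ofReal zero_le_one (by simpa using hratio t)
  have hz_int : ∀ t, Integrable (fun z : Fin T → Fin K → ℝ => z t k) (Measure.pi ρ) := fun t =>
    (measurePreserving_eval ρ t).integrable_comp_of_integrable (hint t)
  have hz_mean : ∀ t, ∫ z : Fin T → Fin K → ℝ, z t k ∂(Measure.pi ρ) = m t := fun t => by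
    rw [← hm t]
    exact integral_comp_eval (μ := ρ) (i := t) (f := fun y : Fin K → ℝ => y k)
      (hint t).aestronglyMeasurable
  -- `log g ≤ log a + (g / a - 1)` replaces the random growth factor by its conditional mean, at
  -- the price of a term whose mean is nonpositive
  set R : (Fin T → Fin K → ℝ) → ℝ := fun z =>
    (T * κ + Real.log K + ∑ t, (η * (z t k - m t) + (g t z / a t z - 1))) / θ with hR
  choose! r hr0 hr1 hr2 using hL
  have hpt : ∀ z, ∑ t, r t (W t z) ≤ R z := fun z => by
    simp only [hR]
    rw [le_div_iff₀ hθ, mul_comm, Finset.mul_sum]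
    have h1 := le_sum_log_sum_normWeight hK η z k
    have h2 : ∀ t, θ * r t (W t z) + Real.log (g t z) ≤
        -η * m t + κ + (g t z / a t z - 1) := fun t => by
      have e1 := hr1 t _ (hWs t z)
      have e2 := Real.log_le_sub_one_of_pos (div_pos (hgpos t z) (hapos t z))
      rw [Real.log_div (hgpos t z).ne' (hapos t z).ne'] at e2
      linarith
    have h3 := Finset.sum_le_sum fun t (_ : t ∈ Finset.univ) => h2 t
    simp only [Finset.sum_add_distrib, Finset.sum_sub_distrib, ← Finset.mul_sum,
      Finset.sum_const, Finset.card_univ, Fintype.card_fin, nsmul_eq_mul, mul_one] at h3 ⊢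
    have h1' : -η * ∑ t, z t k - Real.log K ≤ ∑ t, Real.log (g t z) := h1
    linarith
  have hterm_int : ∀ t ∈ Finset.univ, Integrable (fun z : Fin T → Fin K → ℝ =>
      η * (z t k - m t) + (g t z / a t z - 1)) (Measure.pi ρ) := fun t _ =>
    (((hz_int t).sub (integrable_const _)).const_mul η).add
      ((hratio_int t).sub (integrable_const _))
  have hR_int : Integrable R (Measure.pi ρ) :=
    ((integrable_const _).add (integrable_finsetSum _ hterm_int)).div_const θ
  have hR0 : ∀ z, 0 ≤ R z := fun z =>
    (Finset.sum_nonneg fun t _ => hr0 t _ (hWs t z)).trans (hpt z)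
  have hR_mean : ∫ z, R z ∂(Measure.pi ρ) ≤ (T * κ + Real.log K) / θ := by
    simp only [hR]
    rw [integral_div, integral_add (integrable_const _) (integrable_finsetSum _ hterm_int),
      integral_finsetSum _ hterm_int]
    refine div_le_div_of_nonneg_right ?_ hθ.le
    have : ∀ t, ∫ z : Fin T → Fin K → ℝ, (η * (z t k - m t) + (g t z / a t z - 1))
        ∂(Measure.pi ρ) ≤ 0 := fun t => by
      have i1 : Integrable (fun z : Fin T → Fin K → ℝ => η * (z t k - m t)) (Measure.pi ρ) :=
        ((hz_int t).sub (integrable_const _)).const_mul η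
      have i2 : Integrable (fun z : Fin T → Fin K → ℝ => g t z / a t z - 1) (Measure.pi ρ) :=
        (hratio_int t).sub (integrable_const _)
      rw [integral_add i1 i2, integral_const_mul, integral_sub (hz_int t) (integrable_const _),
        integral_sub (hratio_int t) (integrable_const _), hz_mean t]
      have := hratio_le t
      simp
      linarith
    have := Finset.sum_nonpos fun t (_ : t ∈ Finset.univ) => this t
    simp only [integral_const, probReal_univ, smul_eq_mul, one_mul]
    linarith
  calc ∫⁻ z, ∑ t, L t (W t z) ∂(Measure.pi ρ) ≤ ∫⁻ z, ENNReal.ofReal (R z) ∂(Measure.pi ρ) := by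
        refine lintegral_mono fun z => ?_
        rw [Finset.sum_congr rfl fun t _ => hr2 t _ (hWs t z),
          ← ENNReal.ofReal_sum_of_nonneg fun t _ => hr0 t _ (hWs t z)]
        exact ENNReal.ofReal_le_ofReal (hpt z)
    _ = ENNReal.ofReal (∫ z, R z ∂(Measure.pi ρ)) :=
        (ofReal_integral_eq_lintegral_ofReal hR_int (.of_forall hR0)).symm
    _ ≤ _ := ENNReal.ofReal_le_ofReal hR_mean

end Hedge

/-! ### The law of the messages -/

section Message

variable {X : Type*} {M K T : ℕ} {ε δ γ : ℝ}

theorem measurable_lossVector (p : Fin K → Fin M → ℝ) (c : Cell p) :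
    Measurable (lossVector T ε δ γ p c) := by
  unfold lossVector
  fun_prop

/-- When the label is drawn from hypothesis `k`, the cell is drawn from the clipped
distribution. -/
theorem messageLaw_laplaceMechanism (F : Fin K → X → stdSimplex ℝ (Fin M)) (hT : 0 < T)
    (t : Fin T) (x : X) (k : Fin K) :
    messageLaw (laplaceMechanism T ε δ γ F t x) (F k x) =
      ∑ c : Cell (fun j => F j x), ENNReal.ofReal (clipped T (fun j => F j x) k c) •
        (Measure.pi fun _ : Fin K => laplace (noiseScale K T ε δ)).map
          (lossVector T ε δ γ (fun j => F j x) c) := by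
  simp only [messageLaw, laplaceMechanism, Finset.smul_sum, smul_smul]
  rw [Finset.sum_comm]
  refine Finset.sum_congr rfl fun c _ => ?_
  rw [← Finset.sum_smul]
  congr 1
  have hnn : ∀ y, 0 ≤ clipProb T (fun j => F j x) y c * F k x y := fun y =>
    mul_nonneg (clipProb_nonneg hT y c) ((F k x).2.1 y)
  rw [clipped, ENNReal.ofReal_sum_of_nonneg fun y _ => hnn y]
  refine Finset.sum_congr rfl fun y _ => ?_
  rw [ENNReal.ofReal_mul (clipProb_nonneg hT y c), mul_comm]

theorem isProbabilityMeasure_sum_smul {ι Ω : Type*} [Fintype ι] [MeasurableSpace Ω] {u : ι → ℝ}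
    (hu : ∀ i, 0 ≤ u i) (hsum : ∑ i, u i = 1) (ν : ι → Measure Ω)
    [∀ i, IsProbabilityMeasure (ν i)] :
    IsProbabilityMeasure (∑ i, ENNReal.ofReal (u i) • ν i) := by
  constructor
  simp only [Measure.coe_finsetSum, Finset.sum_apply, Measure.smul_apply, measure_univ,
    smul_eq_mul, mul_one]
  rw [← ENNReal.ofReal_sum_of_nonneg fun i _ => hu i, hsum, ENNReal.ofReal_one]

theorem isProbabilityMeasure_map_lossVector (hb : 0 < noiseScale K T ε δ)
    (p : Fin K → Fin M → ℝ) (c : Cell p) :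
    IsProbabilityMeasure ((Measure.pi fun _ : Fin K => laplace (noiseScale K T ε δ)).map
          (lossVector T ε δ γ p c)) := by
  have := isProbabilityMeasure_laplace hb
  exact Measure.isProbabilityMeasure_map (measurable_lossVector p c).aemeasurable

theorem isProbabilityMeasure_laplaceMechanism (F : Fin K → X → stdSimplex ℝ (Fin M))
    (hK : 0 < K) (hM : 0 < M) (hT : 0 < T) (hb : 0 < noiseScale K T ε δ) (t : Fin T) (x : X)
    (y : Fin M) : IsProbabilityMeasure (laplaceMechanism T ε δ γ F t x y) := by
  have := fun c => isProbabilityMeasure_map_lossVector (γ := γ) hb (fun j => (F j x : Fin M → ℝ)) c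
  exact isProbabilityMeasure_sum_smul (fun c => clipProb_nonneg hT y c)
    (sum_clipProb (fun j => (F j x).2) hK hM hT y) _

theorem isProbabilityMeasure_messageLaw {A : Fin M → Measure (Fin K → ℝ)}
    [∀ y, IsProbabilityMeasure (A y)] {p : Fin M → ℝ} (hp : p ∈ stdSimplex ℝ (Fin M)) :
    IsProbabilityMeasure (messageLaw A p) :=
  isProbabilityMeasure_sum_smul hp.1 hp.2 _

theorem integrable_lossVector (hb : 0 < noiseScale K T ε δ) (p : Fin K → Fin M → ℝ) (c : Cell p)
    (j : Fin K) :
    Integrable (fun z => z j) ((Measure.pi fun _ : Fin K => laplace (noiseScale K T ε δ)).map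
          (lossVector T ε δ γ p c)) ∧
      ∫ z, z j ∂((Measure.pi fun _ : Fin K => laplace (noiseScale K T ε δ)).map
          (lossVector T ε δ γ p c)) =
        -normalization K T ε δ γ *
          (Real.log (clipped T p j c) + Real.log M - offset K T ε δ γ) := by
  have := isProbabilityMeasure_laplace hb
  have hl : Integrable (fun l : Fin K → ℝ => l j)
      (Measure.pi fun _ : Fin K => laplace (noiseScale K T ε δ)) :=
    (measurePreserving_eval (fun _ : Fin K => laplace (noiseScale K T ε δ))
      j).integrable_comp_of_integrable (integrable_id_laplace hb)
  have hl0 : ∫ l : Fin K → ℝ, l j ∂(Measure.pi fun _ : Fin K => laplace (noiseScale K T ε δ)) =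
      0 := by
    rw [← integral_id_laplace (noiseScale K T ε δ)]
    exact integral_comp_eval (μ := fun _ : Fin K => laplace (noiseScale K T ε δ)) (i := j)
      (f := fun y : ℝ => y) (integrable_id_laplace hb).aestronglyMeasurable
  have hmeas := (measurable_lossVector (T := T) (ε := ε) (δ := δ) (γ := γ) p c).aemeasurable
    (μ := Measure.pi fun _ : Fin K => laplace (noiseScale K T ε δ))
  have hform : ∀ l : Fin K → ℝ, lossVector T ε δ γ p c l j =
      -normalization K T ε δ γ * (l j +
          (Real.log (clipped T p j c) + Real.log M - offset K T ε δ γ)) := fun l => by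
    simp only [lossVector]; ring
  constructor
  · rw [integrable_map_measure (measurable_pi_apply j).aestronglyMeasurable hmeas]
    exact ((hl.add (integrable_const _)).const_mul _).congr (.of_forall fun l => (hform l).symm)
  · rw [integral_map hmeas (measurable_pi_apply j).aestronglyMeasurable]
    simp_rw [hform]
    rw [integral_const_mul, integral_add hl (integrable_const _), hl0]
    simp

theorem lintegral_exp_lossVector (hb : 0 < noiseScale K T ε δ) (p : Fin K → Fin M → ℝ)
    (c : Cell p) (j : Fin K) {η : ℝ}
    (hη : |η * normalization K T ε δ γ| * noiseScale K T ε δ < 1) :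
    ∫⁻ z, ENNReal.ofReal (Real.exp (-η * z j))
      ∂((Measure.pi fun _ : Fin K => laplace (noiseScale K T ε δ)).map
          (lossVector T ε δ γ p c)) =
      ENNReal.ofReal (Real.exp (η * normalization K T ε δ γ *
          (Real.log (clipped T p j c) + Real.log M - offset K T ε δ γ)) *
        (1 / (1 - (η * normalization K T ε δ γ) ^ 2 * noiseScale K T ε δ ^ 2))) := by
  have := isProbabilityMeasure_laplace hb
  rw [lintegral_map (by fun_prop) (measurable_lossVector p c)]
  have hform : ∀ l : Fin K → ℝ,
      ENNReal.ofReal (Real.exp (-η * lossVector T ε δ γ p c l j)) =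
      ENNReal.ofReal (Real.exp (η * normalization K T ε δ γ *
          (Real.log (clipped T p j c) + Real.log M - offset K T ε δ γ))) *
        ENNReal.ofReal (Real.exp (η * normalization K T ε δ γ * l j)) := fun l => by
    rw [← ENNReal.ofReal_mul (Real.exp_pos _).le, ← Real.exp_add]
    simp only [lossVector]
    congr 2
    ring
  simp_rw [hform]
  rw [lintegral_const_mul _ (by fun_prop), ENNReal.ofReal_mul (Real.exp_pos _).le,
    ← lintegral_exp_laplace hb hη]
  congr 1
  exact (measurePreserving_eval (fun _ : Fin K => laplace (noiseScale K T ε δ)) j).lintegral_comp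
    (f := fun y => ENNReal.ofReal (Real.exp (η * normalization K T ε δ γ * y))) (by fun_prop)

end Message

/-! ### Privacy of the scheme -/

/-- Mixtures of pairwise indistinguishable measures are indistinguishable. -/
theorem sum_smul_apply_le {ι Ω : Type*} [Fintype ι] [MeasurableSpace Ω] {u v : ι → ℝ}
    (hu : ∀ i, 0 ≤ u i) (hu1 : ∑ i, u i = 1) (hv : ∀ i, 0 ≤ v i) (hv1 : ∑ i, v i = 1)
    {ν : ι → Measure Ω} {S : Set Ω} {E D : ℝ≥0∞} (h : ∀ i i', ν i S ≤ E * ν i' S + D) :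
    (∑ i, ENNReal.ofReal (u i) • ν i) S ≤ E * (∑ i, ENNReal.ofReal (v i) • ν i) S + D := by
  have hsum : ∀ {w : ι → ℝ}, (∀ i, 0 ≤ w i) → ∑ i, w i = 1 →
      ∑ i, ENNReal.ofReal (w i) = 1 := fun hw hw1 => by
    rw [← ENNReal.ofReal_sum_of_nonneg fun i _ => hw i, hw1, ENNReal.ofReal_one]
  simp only [Measure.coe_finsetSum, Finset.sum_apply, Measure.smul_apply, smul_eq_mul]
  set B := E * ∑ i, ENNReal.ofReal (v i) * ν i S + D with hB
  have h1 : ∀ i, ν i S ≤ B := fun i => by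
    calc ν i S = ∑ i', ENNReal.ofReal (v i') * ν i S := by
          rw [← Finset.sum_mul, hsum hv hv1, one_mul]
      _ ≤ ∑ i', ENNReal.ofReal (v i') * (E * ν i' S + D) := by
          gcongr with i'
          exact h i i'
      _ = B := by
          simp only [mul_add, Finset.sum_add_distrib, ← Finset.sum_mul, hsum hv hv1, one_mul, hB,
            Finset.mul_sum]
          congr 1
          exact Finset.sum_congr rfl fun i _ => by ring
  calc ∑ i, ENNReal.ofReal (u i) * ν i S ≤ ∑ i, ENNReal.ofReal (u i) * B := by
        gcongr with i
        exact h1 i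
    _ = B := by rw [← Finset.sum_mul, hsum hu hu1, one_mul]

theorem log_mul_pos {K T : ℕ} (hK : 2 ≤ K) (hT : 0 < T) : 0 < Real.log (K * T) := by
  have hT' : (1 : ℝ) ≤ T := by exact_mod_cast hT
  have hK' : (2 : ℝ) ≤ K := by exact_mod_cast hK
  exact Real.log_pos (by nlinarith)

theorem noiseScale_pos {K T : ℕ} {ε δ : ℝ} (hK : 2 ≤ K) (hT : 0 < T) (hε : 0 < ε) :
    0 < noiseScale K T ε δ := by
  have := log_mul_pos hK hT
  have hK' : (0 : ℝ) < K := by positivity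
  unfold noiseScale
  positivity

/-- Once the cell is fixed, the message is a translated vector of Laplace variables, so that changing
the cell amounts to translating the noise by differences of log-likelihoods. -/
theorem isLDP_laplaceMechanism {X : Type*} {M K T : ℕ} {ε δ : ℝ} (γ : ℝ)
    (F : Fin K → X → stdSimplex ℝ (Fin M)) (hM : 0 < M) (hK : 2 ≤ K) (hT : 0 < T) (hε : 0 < ε)
    (hδ : 0 < δ) (hδ1 : δ ≤ 1) : IsLDP ε δ (laplaceMechanism T ε δ γ F) := by
  have hK0 : 0 < K := by omega
  have hb := noiseScale_pos (δ := δ) hK hT hε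
  have hL := log_mul_pos hK hT
  refine ⟨fun t x y => isProbabilityMeasure_laplaceMechanism F hK0 hM hT hb t x y,
    fun t x y y' S hS => ?_⟩
  set p : Fin K → Fin M → ℝ := fun j => F j x with hp
  have hps : ∀ j, p j ∈ stdSimplex ℝ (Fin M) := fun j => (F j x).2
  refine sum_smul_apply_le (fun c => clipProb_nonneg hT y c) (sum_clipProb hps hK0 hM hT y)
    (fun c => clipProb_nonneg hT y' c) (sum_clipProb hps hK0 hM hT y') fun c c' => ?_
  rw [Measure.map_apply (measurable_lossVector p c) hS,
    Measure.map_apply (measurable_lossVector p c') hS]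
  set a : Fin K → ℝ := fun j =>
    Real.log (clipped T p j c) - Real.log (clipped T p j c') with ha
  have hshift : lossVector T ε δ γ p c ⁻¹' S =
      {l | (fun j => l j + a j) ∈ lossVector T ε δ γ p c' ⁻¹' S} := by
    ext l
    have : lossVector T ε δ γ p c l = lossVector T ε δ γ p c' fun j => l j + a j := by
      ext j
      simp only [lossVector, ha]
      ring
    simp [this]
  rw [hshift]
  -- `r = (4/3) ε / (2 s + q)` is the privacy loss of one coordinate
  set s := Real.sqrt (2 * K * Real.log (1 / δ)) with hs
  set q := Real.sqrt (K * ε) with hq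
  have hK' : (0 : ℝ) < K := by positivity
  have hlog : 0 ≤ Real.log (1 / δ) := Real.log_nonneg (by rw [le_div_iff₀ hδ]; linarith)
  have hs0 : 0 ≤ s := Real.sqrt_nonneg _
  have hq0 : 0 < q := Real.sqrt_pos.2 (by positivity)
  have hs2 : s ^ 2 = 2 * K * Real.log (1 / δ) := Real.sq_sqrt (by positivity)
  have hq2 : q ^ 2 = K * ε := Real.sq_sqrt (by positivity)
  have hrv : 4 / 3 * Real.log (K * T) / noiseScale K T ε δ = 4 / 3 * ε / (2 * s + q) := by
    have : noiseScale K T ε δ = (2 * s + q) * Real.log (K * T) / ε := rfl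
    rw [this]
    field_simp
  have hsq : 0 < 2 * s + q := by positivity
  set r : ℝ := 4 / 3 * ε / (2 * s + q) with hr
  have hrpos : 0 < r := by positivity
  -- the Gaussian tail `r s` and the mean `K r² / 2` of the privacy loss; the noise scale has enough
  -- slack for the factor `4 / 3` in the sensitivity
  have hmain : r * s + K * r ^ 2 / 2 ≤ ε := by
    have e1 : r * s + K * r ^ 2 / 2 =
        ε * ((4 / 3 * s * (2 * s + q) + 8 / 9 * (K * ε)) / (2 * s + q) ^ 2) := by
      rw [hr]; field_simp; ring
    rw [e1, ← hq2]
    refine mul_le_of_le_one_right hε.le ?_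
    rw [div_le_one (by positivity)]
    nlinarith [mul_nonneg hs0 hq0.le, sq_nonneg s, sq_nonneg q]
  have hrs := mul_nonneg hrpos.le hs0
  refine laplace_shift_le (r := ⟨r, hrpos.le⟩) hb hδ hrpos hK0 ?_ ?_ (fun j => ?_)
    (measurable_lossVector p c' hS)
  · change (K : ℝ) * r ^ 2 / 2 ≤ ε
    linarith
  · change 2 * (K : ℝ) * r ^ 2 * Real.log (1 / δ) ≤ (ε - K * r ^ 2 / 2) ^ 2
    calc 2 * (K : ℝ) * r ^ 2 * Real.log (1 / δ) = (r * s) ^ 2 := by rw [mul_pow, hs2]; ring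
      _ ≤ _ := pow_le_pow_left₀ hrs (by linarith) 2
  · change |a j| ≤ r * noiseScale K T ε δ
    rw [← hrv, div_mul_cancel₀ _ hb.ne', abs_le]
    constructor
    · have := log_clipped_sub_le hps hK hM hT j c' c
      simp only [ha]
      linarith
    · exact log_clipped_sub_le hps hK hM hT j c c'

/-! ### The learner -/

theorem isLearner_wmaLearner {X : Type*} {M K T : ℕ} (F : Fin K → X → stdSimplex ℝ (Fin M))
    (hM : 0 < M) (hK : 0 < K) (hT : 0 < T) : IsLearner (wmaLearner T F) := by
  refine fun t x => ⟨measurable_pi_lambda _ fun y => ?_, fun z => ?_⟩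
  · exact Finset.measurable_fun_sum _ fun i _ => Finset.measurable_fun_sum _ fun j _ =>
      (measurable_normWeight _ j).mul_const _
  · exact mixture_mem_stdSimplex (fun j => (F j (x ⟨t, Set.self_mem_Iic⟩)).2) hK hM hT
      (normWeight_mem_stdSimplex hK _ z)

/-! ### The risk bound -/

/-- The cumulant of a bounded nonpositive random variable is at most its mean up to a quadratic
term. -/
theorem log_sum_mul_exp_le {ι : Type*} [Fintype ι] {u v : ι → ℝ} {θ Λ : ℝ} (hu : ∀ i, 0 ≤ u i)
    (hu1 : ∑ i, u i = 1) (hv : ∀ i, -Λ ≤ v i) (hv0 : ∀ i, v i ≤ 0) (hθ : 0 ≤ θ) :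
    Real.log (∑ i, u i * Real.exp (θ * v i)) ≤ θ * ∑ i, u i * v i + θ ^ 2 * Λ ^ 2 / 2 := by
  have hexp : ∀ x : ℝ, x ≤ 0 → Real.exp x ≤ 1 + x + x ^ 2 / 2 := fun x hx => by
    have h := Real.quadratic_le_exp_of_nonneg (neg_nonneg.2 hx)
    have h0 := Real.exp_pos x
    have h1 : Real.exp x * Real.exp (-x) = 1 := by rw [← Real.exp_add]; simp
    have h2 : Real.exp x * (1 + -x + (-x) ^ 2 / 2) ≤ 1 := by
      exact (mul_le_mul_of_nonneg_left h h0.le).trans h1.le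
    have h3 : 0 < 1 + -x + (-x) ^ 2 / 2 := by nlinarith
    have h4 : (1 + x + x ^ 2 / 2) * (1 + -x + (-x) ^ 2 / 2) = 1 + x ^ 4 / 4 := by ring
    refine le_of_mul_le_mul_right (h2.trans ?_) h3
    rw [h4]
    have : 0 ≤ x ^ 4 := by positivity
    linarith
  have hpos : 0 < ∑ i, u i * Real.exp (θ * v i) :=
    sum_mul_pos hu hu1 fun i => Real.exp_pos _
  have hle : ∑ i, u i * Real.exp (θ * v i) ≤
      ∑ i, (u i + θ * (u i * v i) + u i * (θ ^ 2 * Λ ^ 2 / 2)) := by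
    refine Finset.sum_le_sum fun i _ => ?_
    have h1 := hexp (θ * v i) (mul_nonpos_of_nonneg_of_nonpos hθ (hv0 i))
    have h2 : (θ * v i) ^ 2 ≤ θ ^ 2 * Λ ^ 2 := by
      rw [mul_pow]
      refine mul_le_mul_of_nonneg_left ?_ (sq_nonneg θ)
      nlinarith [hv i, hv0 i]
    have h3 : Real.exp (θ * v i) ≤ 1 + θ * v i + θ ^ 2 * Λ ^ 2 / 2 := by linarith
    have := mul_le_mul_of_nonneg_left h3 (hu i)
    linarith
  rw [Finset.sum_add_distrib, Finset.sum_add_distrib, ← Finset.mul_sum, ← Finset.sum_mul, hu1]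
    at hle
  have := Real.log_le_sub_one_of_pos hpos
  linarith

/-- The scaled noise has a moment generating function, and the cumulants of the scaled noise and of
the scaled log-likelihoods are of second order in the learning rate `η`. Here `lk`, `lT` and `L`
stand for `log K`, `log T` and `log (K * T)`. -/
theorem cumulant_le {T lk lT L b Λ η c θ : ℝ} (hT : 1 ≤ T) (hlk : 0.69 ≤ lk) (hlT : 0 ≤ lT)
    (hL : L = lk + lT) (hb : 0 < b) (hΛ0 : 0 ≤ Λ) (hΛ : Λ ≤ 2 * L) (hη : 0 < η)
    (hη2 : η ^ 2 = 2 * lk / T) (hc : c = 1 / (L + 2 * (b * (L + lT)))) (hθ : θ = η * c) :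
    0 < θ ∧ θ * b < 1 ∧
      Real.log (1 / (1 - θ ^ 2 * b ^ 2)) + θ ^ 2 * Λ ^ 2 / 2 ≤ 5 * η ^ 2 := by
  have hT0 : 0 < T := by linarith
  have hlk0 : 0 < lk := by linarith
  have hL0 : 0 < L := by linarith
  have hbT := mul_nonneg hb.le hlT
  have hbL := mul_pos hb hL0
  have hden : 0 < L + 2 * (b * (L + lT)) := by positivity
  have hc0 : 0 < c := by rw [hc]; positivity
  have hθ0 : 0 < θ := by rw [hθ]; positivity
  have hcb : c * b ≤ 1 / (2 * lk) := by
    rw [hc, one_div_mul_eq_div, div_le_div_iff₀ hden (by positivity), hL]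
    nlinarith
  have hcL : c * Λ ≤ 2 := by
    rw [hc, one_div_mul_eq_div, div_le_iff₀ hden]
    linarith
  have hx : (θ * b) ^ 2 ≤ η ^ 2 / (4 * lk ^ 2) := by
    calc (θ * b) ^ 2 = η ^ 2 * (c * b) ^ 2 := by rw [hθ]; ring
      _ ≤ η ^ 2 * (1 / (2 * lk)) ^ 2 := by gcongr
      _ = _ := by ring
  have hlk2 : 1 ≤ 3 * lk ^ 2 := by nlinarith
  have hx34 : (θ * b) ^ 2 ≤ 3 / 4 := by
    refine hx.trans ?_
    rw [hη2, div_div, div_le_div_iff₀ (by positivity) (by positivity)]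
    have h1 : lk ^ 2 ≤ T * lk ^ 2 := le_mul_of_one_le_left (sq_nonneg _) hT
    have h2 : 0.69 * lk ≤ lk ^ 2 := by nlinarith
    linarith
  have hθb : θ * b < 1 := by
    have : 0 < θ * b := by positivity
    nlinarith
  refine ⟨hθ0, hθb, ?_⟩
  have hlogx : Real.log (1 / (1 - (θ * b) ^ 2)) ≤ 3 * η ^ 2 := by
    generalize (θ * b) ^ 2 = x at hx hx34
    have h1x : 0 < 1 - x := by linarith
    rcases le_or_gt x 0 with hx0 | hx0
    · refine (Real.log_nonpos (by positivity) ?_).trans (by positivity)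
      rw [div_le_one h1x]
      linarith
    calc Real.log (1 / (1 - x)) ≤ 1 / (1 - x) - 1 := Real.log_le_sub_one_of_pos (by positivity)
      _ = x / (1 - x) := by field_simp; ring
      _ ≤ 4 * x := by
          rw [div_le_iff₀ h1x]
          have := mul_le_mul_of_nonneg_left hx34 hx0.le
          linarith
      _ ≤ 4 * (η ^ 2 / (4 * lk ^ 2)) := by linarith
      _ = η ^ 2 / lk ^ 2 := by field_simp
      _ ≤ 3 * η ^ 2 := by
          rw [div_le_iff₀ (by positivity)]
          have := mul_le_mul_of_nonneg_left hlk2 (sq_nonneg η)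
          linarith
  have hquad : θ ^ 2 * Λ ^ 2 ≤ 4 * η ^ 2 := by
    calc θ ^ 2 * Λ ^ 2 = η ^ 2 * (c * Λ) ^ 2 := by rw [hθ]; ring
      _ ≤ η ^ 2 * 2 ^ 2 := by gcongr
      _ = _ := by ring
  rw [← mul_pow θ b]
  linarith

/-- The Laplace noise scale, in the terms in which the rate is written. -/
theorem noiseScale_mul_log_le {K T : ℕ} {ε δ : ℝ} (hε : 0 < ε) :
    noiseScale K T ε δ * Real.log (K * T) ≤
      3 * ((Real.sqrt (K * Real.log (1 / δ)) + Real.sqrt (K * ε)) *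
        Real.log (K * T) ^ 2 / ε) := by
  have h1 : Real.sqrt (2 * K * Real.log (1 / δ)) ≤ 3 / 2 * Real.sqrt (K * Real.log (1 / δ)) := by
    rw [mul_assoc, Real.sqrt_mul (by norm_num)]
    have : Real.sqrt 2 ≤ 3 / 2 := by
      rw [Real.sqrt_le_left (by norm_num)]; norm_num
    exact mul_le_mul_of_nonneg_right this (Real.sqrt_nonneg _)
  have h2 := Real.sqrt_nonneg (K * ε)
  unfold noiseScale
  generalize Real.log (K * T) = L
  calc _ = (2 * Real.sqrt (2 * K * Real.log (1 / δ)) + Real.sqrt (K * ε)) * (L ^ 2 / ε) := by ring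
    _ ≤ (3 * (Real.sqrt (K * Real.log (1 / δ)) + Real.sqrt (K * ε))) * (L ^ 2 / ε) := by
        gcongr
        linarith
    _ = _ := by ring

/-- The choice of the parameters: the noise is small enough for the moment generating function of
the scaled losses to exist, and the regret bound is of the order of the rate. -/
theorem regret_le_rate {K T : ℕ} {ε δ : ℝ} (hK : 2 ≤ K) (hT : 0 < T) (hε : 0 < ε) {θ Λ : ℝ}
    (hθ : θ = Real.sqrt (2 * Real.log K / T) * normalization K T ε δ (Real.log T))
    (hΛ : Λ = Real.log ((K + 1) * T)) :
    0 < θ ∧ θ * noiseScale K T ε δ < 1 ∧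
      (T * (Real.log (1 / (1 - θ ^ 2 * noiseScale K T ε δ ^ 2)) + θ ^ 2 * Λ ^ 2 / 2 +
        θ * (1 / T * (1 + 2 * Λ))) + Real.log K) / θ ≤ 100 * rate K T ε δ := by
  have hT1 : (1 : ℝ) ≤ T := by exact_mod_cast hT
  have hT0 : (0 : ℝ) < T := by linarith
  have hK2 : (2 : ℝ) ≤ K := by exact_mod_cast hK
  have hL := log_mul_pos hK hT
  have hb := noiseScale_pos (δ := δ) hK hT hε
  have hsplit : Real.log (K * T) = Real.log K + Real.log T :=
    Real.log_mul (by positivity) (by positivity)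
  have hlT : 0 ≤ Real.log T := Real.log_nonneg hT1
  have hl2 : (0.69 : ℝ) ≤ Real.log K := by
    have := Real.log_two_gt_d9
    have := Real.log_le_log (by norm_num) hK2
    linarith
  have hlk0 : 0 < Real.log K := by linarith
  have hΛ0 : 0 ≤ Λ := hΛ ▸ Real.log_nonneg (by nlinarith)
  have hΛ2 : Λ ≤ 2 * Real.log (K * T) := by
    have : Real.log ((K + 1) * T) ≤ Real.log ((K * T : ℝ) ^ 2) := by
      refine Real.log_le_log (by positivity) ?_
      have h1 : (K : ℝ) + 1 ≤ K ^ 2 := by nlinarith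
      have h2 : (T : ℝ) ≤ T ^ 2 := by nlinarith
      rw [mul_pow]
      gcongr
    rw [Real.log_pow] at this
    rw [hΛ]
    exact_mod_cast this
  have hbL := noiseScale_mul_log_le (K := K) (T := T) (δ := δ) hε
  have hη2 : Real.sqrt (2 * Real.log K / T) ^ 2 = 2 * Real.log K / T :=
    Real.sq_sqrt (by positivity)
  have hη0 : 0 < Real.sqrt (2 * Real.log K / T) := Real.sqrt_pos.2 (by positivity)
  have hTη : T * Real.sqrt (2 * Real.log K / T) = Real.sqrt (2 * T * Real.log K) := by
    have : 2 * (T : ℝ) * Real.log K = T ^ 2 * (2 * Real.log K / T) := by field_simp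
    rw [this, Real.sqrt_mul (sq_nonneg _), Real.sqrt_sq hT0.le]
  have hs1 : 1 ≤ Real.sqrt (2 * T * Real.log K) := by
    rw [Real.one_le_sqrt]
    nlinarith
  have hJ0 : 0 ≤ (Real.sqrt (K * Real.log (1 / δ)) + Real.sqrt (K * ε)) *
      Real.log (K * T) ^ 2 / ε := by positivity
  have hc : normalization K T ε δ (Real.log T) = 1 / (Real.log (K * T) +
      2 * (noiseScale K T ε δ * (Real.log (K * T) + Real.log T))) := by
    rw [normalization, offset, hsplit]; ring
  obtain ⟨hθ0, hθb, hκ⟩ := cumulant_le hT1 hl2 hlT hsplit hb hΛ0 hΛ2 hη0 hη2 hc hθ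
  refine ⟨hθ0, hθb, ?_⟩
  rw [rate]
  have hlTL : Real.log T ≤ Real.log (K * T) := by linarith
  have h2L : 1 ≤ 2 * Real.log (K * T) := by linarith
  generalize (Real.sqrt (K * Real.log (1 / δ)) + Real.sqrt (K * ε)) *
      Real.log (K * T) ^ 2 / ε = J at *
  generalize Real.sqrt (2 * T * Real.log K) = s at *
  generalize Real.sqrt (2 * Real.log K / T) = η at *
  generalize noiseScale K T ε δ = b at *
  generalize normalization K T ε δ (Real.log T) = c at *
  generalize Real.log (1 / (1 - θ ^ 2 * b ^ 2)) + θ ^ 2 * Λ ^ 2 / 2 = κ at *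
  generalize Real.log (K * T) = L at *
  have hinv : 1 / c ≤ 12 * (L + J) := by
    rw [hc, one_div_one_div]
    have := mul_le_mul_of_nonneg_left hlTL hb.le
    linarith
  have hc0 : 0 < c := pos_of_mul_pos_right (hθ ▸ hθ0) hη0.le
  have hlk : Real.log K = T * η ^ 2 / 2 := by rw [hη2]; field_simp
  calc (T * (κ + θ * (1 / T * (1 + 2 * Λ))) + Real.log K) / θ
      ≤ (T * (5 * η ^ 2 + θ * (1 / T * (1 + 2 * Λ))) + T * η ^ 2 / 2) / θ := by
        rw [hlk]
        gcongr
    _ = 11 / 2 * ((T * η) * (1 / c)) + (1 + 2 * Λ) := by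
        rw [hθ]; field_simp; ring
    _ ≤ 11 / 2 * (s * (12 * (L + J))) + (1 + 4 * L) := by
        rw [hTη]
        have := mul_le_mul_of_nonneg_left hinv (zero_le_one.trans hs1)
        linarith
    _ ≤ 100 * (s * (L + J)) := by
        have h1 := mul_le_mul_of_nonneg_right hs1 hL.le
        have h3 := mul_nonneg (zero_le_one.trans hs1) hJ0
        linarith

/-- For the losses that the scheme releases, the mean regret in logarithmic loss is bounded by the
gap between the comparator's mean loss and the mixed cumulant. -/
theorem mul_regret_le {M K T : ℕ} {p : Fin K → Fin M → ℝ}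
    (hp : ∀ j, p j ∈ stdSimplex ℝ (Fin M)) (hK : 0 < K) (hM : 0 < M) (hT : 0 < T)
    {η c o V θ : ℝ} (hθ : θ = η * c) (hθ0 : 0 ≤ θ) (hV : 0 < V) (k : Fin K) {w : Fin K → ℝ}
    (hw : w ∈ stdSimplex ℝ (Fin K)) :
    θ * ∑ i, clipped T p k i *
        (Real.log (clipped T p k i) - ∑ j, w j * Real.log (clipped T p j i)) ≤
      -η * (∑ i, clipped T p k i * (-c * (Real.log (clipped T p k i) + Real.log M - o))) -
        Real.log (∑ j, w j * ∑ i, clipped T p k i *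
          (Real.exp (θ * (Real.log (clipped T p j i) + Real.log M - o)) * V)) +
        (Real.log V + θ ^ 2 * Real.log ((K + 1) * T) ^ 2 / 2) := by
  set q : Cell p → ℝ := clipped T p k with hq
  set v : Fin K → Cell p → ℝ := fun j i => Real.log (clipped T p j i) + Real.log M with hv
  have hq0 : ∀ i, 0 < q i := fun i => clipped_pos hp hK hM hT k i
  have hq1 : ∑ i, q i = 1 := sum_clipped hp hK hM hT k
  set S := ∑ x : Fin K × Cell p, w x.1 * q x.2 * v x.1 x.2 with hS
  set Z := ∑ x : Fin K × Cell p, w x.1 * q x.2 * Real.exp (θ * v x.1 x.2) with hZ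
  have hwq0 : ∀ x : Fin K × Cell p, 0 ≤ w x.1 * q x.2 := fun x => mul_nonneg (hw.1 _) (hq0 _).le
  have hwq1 : ∑ x : Fin K × Cell p, w x.1 * q x.2 = 1 := by
    rw [Fintype.sum_prod_type]
    simp only [← Finset.mul_sum, hq1, mul_one, hw.2]
  have hcum : Real.log Z ≤ θ * S + θ ^ 2 * Real.log ((K + 1) * T) ^ 2 / 2 :=
    log_sum_mul_exp_le (v := fun x : Fin K × Cell p => v x.1 x.2) hwq0 hwq1
      (fun x => neg_log_le_log_clipped hp hK hM hT x.1 x.2)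
      (fun x => log_clipped_add_le hp hK hM hT x.1 x.2) hθ0
  have hZpos : 0 < Z := sum_mul_pos hwq0 hwq1 fun x => Real.exp_pos _
  have hA : ∑ j, w j * ∑ i, q i * (Real.exp (θ * (v j i - o)) * V) =
      Z * (Real.exp (-(θ * o)) * V) := by
    rw [hZ, Fintype.sum_prod_type, Finset.sum_mul]
    refine Finset.sum_congr rfl fun j _ => ?_
    rw [Finset.mul_sum, Finset.sum_mul]
    refine Finset.sum_congr rfl fun i _ => ?_
    rw [mul_sub, sub_eq_add_neg, Real.exp_add]
    ring
  have hm : ∑ i, q i * (-c * (v k i - o)) = -c * (∑ i, q i * v k i - o) := by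
    calc _ = ∑ i, (-c * (q i * v k i) + c * o * q i) := by
          exact Finset.sum_congr rfl fun i _ => by ring
      _ = _ := by
          rw [Finset.sum_add_distrib, ← Finset.mul_sum, ← Finset.mul_sum, hq1]; ring
  have hD : ∑ i, q i * (Real.log (q i) - ∑ j, w j * Real.log (clipped T p j i)) =
      ∑ i, q i * v k i - S := by
    rw [hS, Fintype.sum_prod_type, Finset.sum_comm, ← Finset.sum_sub_distrib]
    refine Finset.sum_congr rfl fun i _ => ?_
    have e : ∑ j, w j * q i * v j i =
        q i * (∑ j, w j * Real.log (clipped T p j i) + Real.log M) := by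
      calc _ = ∑ j, (q i * (w j * Real.log (clipped T p j i)) + q i * Real.log M * w j) :=
            Finset.sum_congr rfl fun j _ => by simp only [hv]; ring
        _ = _ := by
            rw [Finset.sum_add_distrib, ← Finset.mul_sum, ← Finset.mul_sum, hw.2]; ring
    rw [e]
    simp only [hv, hq]
    ring
  have hvk : ∀ j i, Real.log (clipped T p j i) + Real.log M - o = v j i - o := fun _ _ => rfl
  simp only [hvk]
  rw [hA, hm, hD, Real.log_mul hZpos.ne' (by positivity), Real.log_mul (by positivity) hV.ne',
    Real.log_exp]
  subst hθ
  linarith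

/-- The learner is the exponential weights forecaster for the released losses. -/
theorem worstKL_wmaLearner_le {X : Type*} {M K T : ℕ} {ε δ : ℝ}
    (F : Fin K → X → stdSimplex ℝ (Fin M)) (hM : 0 < M) (hK : 2 ≤ K) (hT : 0 < T) (hε : 0 < ε) :
    worstKL F (laplaceMechanism T ε δ (Real.log T) F) (wmaLearner T F) ≤
      ENNReal.ofReal (100 * rate K T ε δ) := by
  refine iSup₂_le fun k x => ?_
  have hK0 : 0 < K := by omega
  have hb := noiseScale_pos (δ := δ) hK hT hε
  have hps : ∀ t j, (F j (x t) : Fin M → ℝ) ∈ stdSimplex ℝ (Fin M) := fun t j => (F j (x t)).2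
  set η := Real.sqrt (2 * Real.log K / T) with hη
  set c := normalization K T ε δ (Real.log T) with hc
  set o := offset K T ε δ (Real.log T) with ho
  set b := noiseScale K T ε δ with hbdef
  obtain ⟨hθ0, hθb, hfin⟩ := regret_le_rate (δ := δ) hK hT hε (θ := η * c) rfl rfl
  have hθabs : |η * c| * b < 1 := by rwa [abs_of_pos hθ0]
  set V := 1 / (1 - (η * c) ^ 2 * b ^ 2) with hV
  have hV0 : 0 < V := by
    have h1 : (η * c) ^ 2 * b ^ 2 < 1 := by
      rw [← mul_pow]
      exact pow_lt_one₀ (by positivity) hθb two_ne_zero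
    exact one_div_pos.2 (by linarith)
  set p : Fin T → Fin K → Fin M → ℝ := fun t j => F j (x t) with hp
  have hcl0 : ∀ t j i, 0 < clipped T (p t) j i := fun t j i => clipped_pos (hps t) hK0 hM hT j i
  have hprob : ∀ t y,
      IsProbabilityMeasure (laplaceMechanism T ε δ (Real.log T) F t (x t) y) := fun t y =>
    isProbabilityMeasure_laplaceMechanism F hK0 hM hT hb t (x t) y
  have hprob2 : ∀ t, IsProbabilityMeasure
      (messageLaw (laplaceMechanism T ε δ (Real.log T) F t (x t)) (F k (x t))) := fun t =>
    isProbabilityMeasure_messageLaw (F k (x t)).2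
  have hprob3 : ∀ t (i : Cell (p t)), IsProbabilityMeasure
      ((Measure.pi fun _ : Fin K => laplace b).map (lossVector T ε δ (Real.log T) (p t) i)) :=
    fun t i => isProbabilityMeasure_map_lossVector hb (p t) i
  have hlaw := fun t => messageLaw_laplaceMechanism (ε := ε) (δ := δ) (γ := Real.log T) F hT t
    (x t) k
  have hint : ∀ t (i : Cell (p t)), Integrable (fun z : Fin K → ℝ => z k)
      (ENNReal.ofReal (clipped T (p t) k i) • (Measure.pi fun _ : Fin K => laplace b).map
        (lossVector T ε δ (Real.log T) (p t) i)) := fun t i =>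
    (integrable_lossVector hb (p t) i k).1.smul_measure ENNReal.ofReal_ne_top
  have key := lintegral_sum_cost_le hK0 (η := η) (θ := η * c)
    (κ := Real.log V + (η * c) ^ 2 * Real.log ((K + 1) * T) ^ 2 / 2 +
      η * c * (1 / T * (1 + 2 * Real.log ((K + 1) * T)))) hθ0
    (fun t => messageLaw (laplaceMechanism T ε δ (Real.log T) F t (x t)) (F k (x t))) k
    (m := fun t => ∑ i, clipped T (p t) k i *
      (-c * (Real.log (clipped T (p t) k i) + Real.log M - o)))
    (A := fun t j => ∑ i, clipped T (p t) k i *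
      (Real.exp (η * c * (Real.log (clipped T (p t) j i) + Real.log M - o)) * V))
    (L := fun t w => kl (p t k)
      (fun y => ∑ i : Fin (cellCount (p t) y), ∑ j, w j * clipped T (p t) j ⟨y, i⟩))
    ?_ ?_ ?_ ?_ ?_
  · exact key.trans (ENNReal.ofReal_le_ofReal hfin)
  · intro t
    rw [hlaw]
    exact integrable_finsetSum_measure.2 fun i _ => hint t i
  · intro t
    rw [hlaw, integral_finsetSum_measure fun i _ => hint t i]
    refine Finset.sum_congr rfl fun i _ => ?_
    rw [integral_smul_measure, ENNReal.toReal_ofReal (hcl0 t k i).le,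
      (integrable_lossVector hb (p t) i k).2, smul_eq_mul]
  · intro t j
    obtain ⟨i⟩ : Nonempty (Cell (p t)) :=
      Fintype.card_pos_iff.1 (by exact_mod_cast card_cell_pos (hps t) hK0 hM)
    exact Finset.sum_pos (fun i _ => mul_pos (hcl0 t k i) (mul_pos (Real.exp_pos _) hV0))
      ⟨i, Finset.mem_univ i⟩
  · intro t j
    rw [hlaw, lintegral_finsetSum_measure, ENNReal.ofReal_sum_of_nonneg fun i _ =>
      (mul_pos (hcl0 t k i) (mul_pos (Real.exp_pos _) hV0)).le]
    refine Finset.sum_congr rfl fun i _ => ?_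
    rw [lintegral_smul_measure, ENNReal.ofReal_mul (hcl0 t k i).le, smul_eq_mul]
    congr 1
    exact lintegral_exp_lossVector hb (p t) i j hθabs
  · intro t w hw
    obtain ⟨r, hr0, hr1, hr2⟩ := kl_mixture_le (hps t) hK0 hM hT hw k
    refine ⟨r, hr0, ?_, hr2⟩
    have h1 := mul_le_mul_of_nonneg_left hr1 hθ0.le
    have h2 := mul_regret_le (hps t) hK0 hM hT (o := o) rfl hθ0.le hV0 k hw
    rw [mul_add] at h1
    linarith

/-- With a single hypothesis there is nothing to learn: predicting it costs nothing, and an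
uninformative message is private. -/
theorem exists_worstKL_eq_zero {X : Type*} {M T : ℕ} {ε δ : ℝ}
    (F : Fin 1 → X → stdSimplex ℝ (Fin M)) (hε : 0 < ε) :
    ∃ (R : Mechanism X M 1 T) (Φ : Learner X M 1 T),
      IsLDP ε δ R ∧ IsLearner Φ ∧ worstKL F R Φ = 0 := by
  refine ⟨fun _ _ _ => Measure.dirac 0, fun t x _ => F 0 (x ⟨t, Set.self_mem_Iic⟩),
    ⟨fun _ _ _ => inferInstance, fun t x y y' S _ => ?_⟩,
    fun t x => ⟨measurable_const, fun z => (F 0 _).2⟩, ?_⟩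
  · refine le_trans ?_ le_self_add
    refine le_mul_of_one_le_left bot_le ?_
    rw [ENNReal.one_le_ofReal]
    exact Real.one_le_exp hε.le
  · have hkl : ∀ p : Fin M → ℝ, kl p p = 0 := fun p => by
      rw [kl, if_pos fun y h => h]
      simp
    simp only [worstKL, ENNReal.iSup_eq_zero]
    intro j x
    rw [Subsingleton.elim j 0, expectedKL]
    simp [hkl]

end PrivateOnline

theorem mainTheorem2 :
    ∃ C : ℝ, 0 < C ∧
      ∀ (X : Type*) (M K T : ℕ) (ε δ : ℝ) (F : Fin K → X → stdSimplex ℝ (Fin M)),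
        1 ≤ M → 1 ≤ K → 1 ≤ T → 0 < ε → 0 < δ → δ ≤ 1 →
        (∃ (R : PrivateOnline.Mechanism X M K T) (Φ : PrivateOnline.Learner X M K T),
          PrivateOnline.IsLDP ε δ R ∧ PrivateOnline.IsLearner Φ ∧
          PrivateOnline.worstKL F R Φ ≤ ENNReal.ofReal (C * PrivateOnline.rate K T ε δ)) ∧
        PrivateOnline.minimaxKL T ε δ F ≤ ENNReal.ofReal (C * PrivateOnline.rate K T ε δ) ∧
        (2 ≤ K →
          PrivateOnline.IsLDP ε δ (PrivateOnline.laplaceMechanism T ε δ (Real.log T) F) ∧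
          PrivateOnline.IsLearner (PrivateOnline.wmaLearner T F) ∧
          PrivateOnline.worstKL F (PrivateOnline.laplaceMechanism T ε δ (Real.log T) F)
            (PrivateOnline.wmaLearner T F) ≤
              ENNReal.ofReal (C * PrivateOnline.rate K T ε δ)) := by
  refine ⟨100, by norm_num, fun X M K T ε δ F hM hK hT hε hδ hδ1 => ?_⟩
  have hwma : 2 ≤ K →
      PrivateOnline.IsLDP ε δ (PrivateOnline.laplaceMechanism T ε δ (Real.log T) F) ∧
      PrivateOnline.IsLearner (PrivateOnline.wmaLearner T F) ∧
      PrivateOnline.worstKL F (PrivateOnline.laplaceMechanism T ε δ (Real.log T) F)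
        (PrivateOnline.wmaLearner T F) ≤
          ENNReal.ofReal (100 * PrivateOnline.rate K T ε δ) := fun hK2 =>
    ⟨PrivateOnline.isLDP_laplaceMechanism _ F hM hK2 hT hε hδ hδ1,
      PrivateOnline.isLearner_wmaLearner F hM hK hT,
      PrivateOnline.worstKL_wmaLearner_le F hM hK2 hT hε⟩
  have hex : ∃ (R : PrivateOnline.Mechanism X M K T) (Φ : PrivateOnline.Learner X M K T),
      PrivateOnline.IsLDP ε δ R ∧ PrivateOnline.IsLearner Φ ∧
      PrivateOnline.worstKL F R Φ ≤ ENNReal.ofReal (100 * PrivateOnline.rate K T ε δ) := by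
    rcases hK.eq_or_lt with rfl | hK2
    · obtain ⟨R, Φ, h1, h2, h3⟩ := PrivateOnline.exists_worstKL_eq_zero (T := T) (δ := δ) F hε
      exact ⟨R, Φ, h1, h2, h3.le.trans bot_le⟩
    · exact ⟨_, _, hwma hK2⟩
  refine ⟨hex, ?_, hwma⟩
  obtain ⟨R, Φ, h1, h2, h3⟩ := hex
  exact (iInf₂_le_of_le R Φ (iInf₂_le h1 h2)).trans h3
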